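/- Let $n\ge 1$ agents $\mathcal V=\{1,\dots,n\}$ minimize $f(x)=\sum_{i=1}^n f_i(x)$ over $x\in\mathbb R^d$, where $f_i(x)=\mathbb E_{\xi_i\sim\mathcal D_i}[\ell_i(x,\xi_i)]$. Assume the following. (1) Each $f_i$ is differentiable, and there are constants $L_i>0$ and $\mu>0$ with $\|\nabla f_i(x)-\nabla f_i(y)\|\le L_i\|x-y\|$ and $\langle\nabla f_i(x)-\nabla f_i(y),x-y\rangle\ge\mu\|x-y\|^2$ for all $x,y\in\mathbb R^d$ and all $i$. Put $L^2=\sum_{i=1}^n L_i^2$. (2) There is $\sigma_g>0$ such that the sampled gradients $g_i(x,\xi)$ satisfy $\mathbb E_{\xi\sim\mathcal D_i}[g_i(x,\xi)]=\nabla f_i(x)$ and $\mathbb E_{\xi\sim\mathcal D_i}[\|g_i(x,\xi)-\nabla f_i(x)\|^2]\le\sigma_g^2$ for all $i$ and all $x\in\mathbb R^d$. (3) $\mathcal G$ is a connected undirected graph on $\mathcal V$ with neighborhoods $\mathcal N_i\ni i$, and $A=[a_{ij}]$ is a doubly stochastic matrix such that, for some $\eta>0$, $a_{ij}>\eta$ if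 $j\in\mathcal N_i$ and $a_{ij}=0$ if $j\notin\mathcal N_i$. Let $\sigma_2$ be the second largest singular value of $A$ ($\sigma_2=0$ if $n=1$). (4) The step sizes $\alpha_k>0$ and $0<\beta_k<1$, the noise parameters $\sigma_k>0$ and the sample sizes $\gamma_k\in\{1,2,\dots\}$, $k\ge 0$, satisfy $$\sup_k\frac{\alpha_k}{\beta_k}\le\min\Big\{\frac{2(1-\sigma_2)}{3\mu},\ \frac{(1-\sigma_2)^2\mu^2\beta_0}{16\,(6L^2\alpha_0+n(1-\sigma_2)\mu\beta_0)(\beta_0+1)L^2}\Big\},$$ $$\sum_{k=0}^\infty\alpha_k=\infty,\quad \sum_{k=0}^\infty\frac{\alpha_k^2}{\beta_k}<\infty,\quad \sum_{k=0}^\infty\beta_k^2\sigma_k^2<\infty,\quad \sum_{k=0}^\infty\frac{\alpha_k^2}{\gamma_k\beta_k}<\infty,\quad \sum_{k=0}^\infty\frac{\alpha_k^2}{\gamma_k}<\infty.$$ From arbitrary deterministic initial values $x_{i,0}\in\mathbb R^d$, the agents iterate $$x_{i,k+1}=(1-\beta_k)x_{i,k}+\beta_k\sum_{j\in\mathcal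 N_i}a_{ij}(x_{j,k}+n_{j,k})-\frac{\alpha_k}{\gamma_k}\sum_{l=1}^{\gamma_k}g_i(x_{i,k},\xi_{i,k}^{l}),$$ where the noise vectors $n_{i,k}\in\mathbb R^d$ are independent over all $i$ and $k$, each coordinate of $n_{i,k}$ has the centered Laplace distribution with variance $2\sigma_k^2$, the samples $\xi_{i,k}^1,\dots,\xi_{i,k}^{\gamma_k}$ are independent with law $\mathcal D_i$ for each $i$ and $k$, the collections of all samples drawn at different times are independent, and the noises are independent of the samples. Then there is a minimizer $x^*$ of $f$ such that, for every $i\in\mathcal V$, $$\lim_{k\to\infty}\mathbb E\big[\|x_{i,k}-x^*\|^2\big]=0\qquad\text{and}\qquad \lim_{k\to\infty}x_{i,k}=x^*\ \text{ almost surely.}$$ -/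

import Mathlib

open MeasureTheory ProbabilityTheory Filter Topology

noncomputable section

/-- The centred Laplace distribution with scale `b > 0`: density `exp (-|t| / b) / (2 b)`,
variance `2 b ^ 2`. -/
def laplaceMeasure (b : ℝ) : Measure ℝ :=
  volume.withDensity fun t => ENNReal.ofReal ((2 * b)⁻¹ * Real.exp (-|t| / b))

/-- The expected local costs `f i x = 𝔼_{s ∼ D i} [ℓ i x s]`. -/
def expectedCost {n d : ℕ} {Ξ : Fin n → Type*} [∀ i, MeasurableSpace (Ξ i)]
    (D : ∀ i, Measure (Ξ i)) (ℓ : ∀ i, EuclideanSpace ℝ (Fin d) → Ξ i → ℝ)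
    (i : Fin n) (x : EuclideanSpace ℝ (Fin d)) : ℝ :=
  ∫ s, ℓ i x s ∂(D i)

/-- Every `f i` is differentiable, its gradient is Lipschitz with constant `L i`, and `f i` is
`m`-strongly convex, expressed through the gradient. -/
structure SmoothStronglyConvex {n d : ℕ} (f : Fin n → EuclideanSpace ℝ (Fin d) → ℝ)
    (L : Fin n → ℝ) (m : ℝ) : Prop where
  L_pos : ∀ i, 0 < L i
  m_pos : 0 < m
  differentiable : ∀ i, Differentiable ℝ (f i)
  lipschitz : ∀ i x y, ‖gradient (f i) x - gradient (f i) y‖ ≤ L i * ‖x - y‖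
  strongly_convex : ∀ i x y,
    m * ‖x - y‖ ^ 2 ≤ inner ℝ (gradient (f i) x - gradient (f i) y) (x - y)

/-- The sampled gradients `g i x s`, `s ∼ D i`, are unbiased estimators of the gradient of `f i`
at `x`, with variance at most `σg ^ 2`, uniformly in the agent `i` and the point `x`. -/
structure UnbiasedBoundedVariance {n d : ℕ} {Ξ : Fin n → Type*} [∀ i, MeasurableSpace (Ξ i)]
    (D : ∀ i, Measure (Ξ i)) (f : Fin n → EuclideanSpace ℝ (Fin d) → ℝ)
    (g : ∀ i, EuclideanSpace ℝ (Fin d) → Ξ i → EuclideanSpace ℝ (Fin d)) (σg : ℝ) : Prop where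
  σg_pos : 0 < σg
  measurable : ∀ i, Measurable fun p : EuclideanSpace ℝ (Fin d) × Ξ i => g i p.1 p.2
  integrable : ∀ i x, Integrable (g i x) (D i)
  unbiased : ∀ i x, ∫ s, g i x s ∂(D i) = gradient (f i) x
  integrable_sq : ∀ i x, Integrable (fun s => ‖g i x s - gradient (f i) x‖ ^ 2) (D i)
  variance_le : ∀ i x, ∫ s, ‖g i x s - gradient (f i) x‖ ^ 2 ∂(D i) ≤ σg ^ 2

/-- The undirected graph `G` is connected, and `A` is a doubly stochastic weight matrix whose
entries are bounded below by a positive constant on the neighbourhoods `N i = {i} ∪ {j | i ~ j}`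
and vanish elsewhere. The weights need not be symmetric. -/
structure ConnectedWeights {n : ℕ} (G : SimpleGraph (Fin n)) (A : Matrix (Fin n) (Fin n) ℝ) :
    Prop where
  connected : G.Connected
  weights_lower_bound : ∃ η > 0, ∀ i j, (j = i ∨ G.Adj i j) → η < A i j
  weights_eq_zero : ∀ i j, ¬ (j = i ∨ G.Adj i j) → A i j = 0
  doubly_stochastic : A ∈ doublyStochastic ℝ (Fin n)

/-- The second largest singular value of `A`, counted with multiplicity (`0` for a `1 × 1`
matrix). Mathlib numbers the singular values from `0` in decreasing order. -/
def secondSingularValue {n : ℕ} (A : Matrix (Fin n) (Fin n) ℝ) : ℝ :=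
  (Matrix.toEuclideanLin A).singularValues 1

/-- Conditions on the step sizes `α`, `β`, the noise parameters `σ` and the sample sizes `γ`,
for `n` agents; `σ₂` is the second singular value of the weight matrix, `m` the constant of strong
convexity, and `Lsq = ∑ i, L i ^ 2`. -/
structure TwoTimeScale (n : ℕ) (σ₂ m Lsq : ℝ) (α β σ : ℕ → ℝ) (γ : ℕ → ℕ) : Prop where
  α_pos : ∀ k, 0 < α k
  β_pos : ∀ k, 0 < β k
  β_lt_one : ∀ k, β k < 1
  σ_pos : ∀ k, 0 < σ k
  γ_pos : ∀ k, 1 ≤ γ k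
  ratio_le : ∀ k, α k / β k ≤ min (2 * (1 - σ₂) / (3 * m))
    ((1 - σ₂) ^ 2 * m ^ 2 * β 0 /
      (16 * (6 * Lsq * α 0 + n * (1 - σ₂) * m * β 0) * (β 0 + 1) * Lsq))
  summable_α_sq_div_β : Summable fun k => α k ^ 2 / β k
  summable_β_sq_mul_σ_sq : Summable fun k => β k ^ 2 * σ k ^ 2
  summable_α_sq_div_γ_β : Summable fun k => α k ^ 2 / (γ k * β k)
  summable_α_sq_div_γ : Summable fun k => α k ^ 2 / γ k

/-- The privacy noise vectors `noise i k` are independent over the agents `i` and the times `k`,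
and each coordinate of `noise i k` is centred Laplace with scale `σ k`. -/
structure LaplaceNoise {n d : ℕ} {Ω : Type*} [MeasurableSpace Ω] (P : Measure Ω) (σ : ℕ → ℝ)
    (noise : Fin n → ℕ → Ω → EuclideanSpace ℝ (Fin d)) : Prop where
  measurable : ∀ i k, Measurable (noise i k)
  law : ∀ i k r, P.map (fun ω => noise i k ω r) = laplaceMeasure (σ k)
  indep : iIndepFun (fun p : Fin n × ℕ => noise p.1 p.2) P

/-- The data samples: at time `k`, agent `i` draws `γ k` independent samples `ξ i k l` from its
local distribution `D i`, and the draws made at different times are independent. No independence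
across the agents is required. -/
structure FreshSamples {n : ℕ} {Ω : Type*} [MeasurableSpace Ω] (P : Measure Ω)
    {Ξ : Fin n → Type*} [∀ i, MeasurableSpace (Ξ i)] (D : ∀ i, Measure (Ξ i)) (γ : ℕ → ℕ)
    (ξ : ∀ (i : Fin n) (k : ℕ), Fin (γ k) → Ω → Ξ i) : Prop where
  measurable : ∀ i k l, Measurable (ξ i k l)
  law : ∀ i k l, P.map (ξ i k l) = D i
  indep_draws : ∀ i k, iIndepFun (fun l => ξ i k l) P
  indep_times : iIndepFun (fun k ω => fun (i : Fin n) (l : Fin (γ k)) => ξ i k l ω) P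

/-- The iterates `x_{i,k}` of the output-perturbation algorithm: every agent shares only its noisy
state, mixes the noisy states that it receives, and moves along its averaged sampled gradient. The
weights `A i j` vanish for `j` outside the neighbourhood of `i`. -/
def outputPerturbation {n d : ℕ} {Ω : Type*} {Ξ : Fin n → Type*}
    (A : Matrix (Fin n) (Fin n) ℝ) (α β : ℕ → ℝ) (γ : ℕ → ℕ)
    (g : ∀ i, EuclideanSpace ℝ (Fin d) → Ξ i → EuclideanSpace ℝ (Fin d))
    (x₀ : Fin n → EuclideanSpace ℝ (Fin d))
    (noise : Fin n → ℕ → Ω → EuclideanSpace ℝ (Fin d))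
    (ξ : ∀ (i : Fin n) (k : ℕ), Fin (γ k) → Ω → Ξ i) :
    ℕ → Fin n → Ω → EuclideanSpace ℝ (Fin d)
  | 0, i, _ => x₀ i
  | k + 1, i, ω =>
    let x := fun j => outputPerturbation A α β γ g x₀ noise ξ k j ω
    (1 - β k) • x i + β k • ∑ j, A i j • (x j + noise j k ω)
      - α k • ((γ k : ℝ)⁻¹ • ∑ l, g i (x i) (ξ i k l ω))

end

/-!
Write `p` for the zero of the total gradient, which is the minimizer. The distance of the states to
`p` is measured by the Lyapunov function `W = ‖z̄‖ ^ 2 + c * ∑ i, ‖z i - z̄‖ ^ 2`, where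
`z i = x i - p` and `z̄` is the average of the `z i`.

The noiseless update shrinks `W`: strong convexity contracts the average at rate `α k`, and `A`
contracts the disagreement at rate `β k (1 - σ₂)`, because on vectors with mean zero a doubly
stochastic matrix has norm `σ₂`. For `c` large, the bound `3 m α k ≤ 2 (1 - σ₂) β k` lets the second
effect absorb the disagreement that enters the average. This gives
`W⁺ ≤ (1 - m α k / 2 + K α k ^ 2 / β k) W + K α k ^ 2 / β k` (`lyapunov_drift_le`).

The privacy noise and the sampling error of round `k` are centred and fresh, that is, independent of
the history (`indep_history_noise`, `indep_history_sample`), so they are orthogonal to everything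
known before and raise the conditional mean of `W` by their second moment only, which is of order
`β k ^ 2 σ k ^ 2 + α k ^ 2` (`setIntegral_lyapunov_succ_le`). All these errors are summable while
`∑ α k = ∞`, and the Robbins–Siegmund theorem (`robbins_siegmund`) gives `W → 0` both in mean and
almost surely.

Conditional expectations are expressed throughout by integrals over events of the history.
-/

/-! ### The second singular value of a doubly stochastic matrix -/

/-- On vectors with mean zero, a doubly stochastic matrix contracts by its second singular value.
The hypothesis `secondSingularValue A < 1` makes the singular value `1`, attained at the all-ones
vector, simple, so that all the other right singular vectors have mean zero. -/
theorem sum_sq_mulVec_le_of_sum_eq_zero {n : ℕ} {A : Matrix (Fin n) (Fin n) ℝ}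
    (hA : A ∈ doublyStochastic ℝ (Fin n)) (h1 : secondSingularValue A < 1) {y : Fin n → ℝ}
    (hy : ∑ i, y i = 0) :
    ∑ i, (∑ j, A i j * y j) ^ 2 ≤ secondSingularValue A ^ 2 * ∑ i, y i ^ 2 := by
  rcases n with _ | _ | n
  · simp
  · have : y 0 = 0 := by simpa using hy
    simp [this]
  set T := Matrix.toEuclideanLin A with hT
  have hn : Module.finrank ℝ (EuclideanSpace ℝ (Fin (n + 2))) = n + 2 := by simp
  set hS := T.isSymmetric_adjoint_comp_self
  set b := hS.eigenvectorBasis hn with hb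
  set ev := hS.eigenvalues hn with hev
  have hσ : secondSingularValue A ^ 2 = ev 1 := T.sq_singularValues_fin hn 1
  have hσ0 : 0 ≤ secondSingularValue A := T.singularValues_nonneg 1
  set one : EuclideanSpace ℝ (Fin (n + 2)) := WithLp.toLp 2 1 with hone
  set v : EuclideanSpace ℝ (Fin (n + 2)) := WithLp.toLp 2 y with hv
  have hadj : T.adjoint = Matrix.toEuclideanLin A.transpose := by
    rw [hT, ← Matrix.toEuclideanLin_conjTranspose_eq_adjoint]
    rfl
  have hSone : (T.adjoint ∘ₗ T) one = one := by
    have h1 : T one = one := by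
      ext i
      simp [hT, hone, mulVec_one_of_mem_doublyStochastic hA]
    rw [LinearMap.comp_apply, h1, hadj]
    ext i
    simp [hone, Matrix.mulVec_transpose, one_vecMul_of_mem_doublyStochastic hA]
  have hev_le : ∀ i : Fin (n + 2), i ≠ 0 → ev i ≤ ev 1 := fun i hi =>
    hS.eigenvalues_antitone hn (Fin.one_le_of_ne_zero hi)
  have hev1 : ev 1 < 1 := by
    rw [← hσ]; nlinarith
  have hbS : ∀ i w, inner ℝ (b i) ((T.adjoint ∘ₗ T) w) = ev i * inner ℝ (b i) w := by
    intro i w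
    rw [← hS (b i) w, hS.apply_eigenvectorBasis hn i]
    simp [inner_smul_left, hev, hb]
  -- eigenvectors of different eigenvalues are orthogonal
  have hone_orth : ∀ i : Fin (n + 2), i ≠ 0 → inner ℝ (b i) one = 0 := by
    intro i hi
    have := hbS i one
    rw [hSone] at this
    have h2 : (1 - ev i) * inner ℝ (b i) one = 0 := by linarith
    rcases mul_eq_zero.1 h2 with h | h
    · have := hev_le i hi; linarith
    · exact h
  have hb0 : inner ℝ (b 0) v = 0 := by
    have h0 : inner ℝ one v = 0 := by
      simp [hone, hv, PiLp.inner_apply, hy]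
    rw [← b.sum_inner_mul_inner one v, Finset.sum_eq_single 0] at h0
    · rcases mul_eq_zero.1 h0 with h | h
      · exfalso
        have h3 : one = 0 := by
          rw [← b.sum_repr' one]
          refine Finset.sum_eq_zero fun i _ => ?_
          by_cases hi : i = 0
          · rw [hi, real_inner_comm, h, zero_smul]
          · rw [hone_orth i hi, zero_smul]
        have := congrArg (fun u : EuclideanSpace ℝ (Fin (n + 2)) => u 0) h3
        simp [hone] at this
      · exact h
    · intro i _ hi
      rw [real_inner_comm, hone_orth i hi, zero_mul]
    · simp
  have hTv : ∑ i, (∑ j, A i j * y j) ^ 2 = ‖T v‖ ^ 2 := by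
    simp [EuclideanSpace.norm_sq_eq, hT, hv, Matrix.mulVec, dotProduct]
  have hvn : ∑ i, y i ^ 2 = ‖v‖ ^ 2 := by
    simp [EuclideanSpace.norm_sq_eq, hv]
  have hTv2 : ‖T v‖ ^ 2 = ∑ i, ev i * inner ℝ (b i) v ^ 2 := by
    rw [← real_inner_self_eq_norm_sq, ← LinearMap.adjoint_inner_right,
      ← b.sum_inner_mul_inner]
    refine Finset.sum_congr rfl fun i _ => ?_
    have := hbS i v
    rw [LinearMap.comp_apply] at this
    rw [this, real_inner_comm]; ring
  have hvn2 : ‖v‖ ^ 2 = ∑ i, inner ℝ (b i) v ^ 2 := by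
    rw [← real_inner_self_eq_norm_sq, ← b.sum_inner_mul_inner]
    refine Finset.sum_congr rfl fun i _ => ?_
    rw [real_inner_comm]; ring
  rw [hTv, hvn, hTv2, hvn2, hσ, Finset.mul_sum]
  refine Finset.sum_le_sum fun i _ => ?_
  by_cases hi : i = 0
  · simp [hi, hb0]
  · exact mul_le_mul_of_nonneg_right (hev_le i hi) (sq_nonneg _)

/-- The contraction of `sum_sq_mulVec_le_of_sum_eq_zero` for vector-valued states, coordinate by
coordinate. -/
theorem sum_norm_sq_mix_le {n d : ℕ} {A : Matrix (Fin n) (Fin n) ℝ}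
    (hA : A ∈ doublyStochastic ℝ (Fin n)) (h1 : secondSingularValue A < 1)
    {y : Fin n → EuclideanSpace ℝ (Fin d)} (hy : ∑ i, y i = 0) :
    ∑ i, ‖∑ j, A i j • y j‖ ^ 2 ≤ secondSingularValue A ^ 2 * ∑ i, ‖y i‖ ^ 2 := by
  simp only [EuclideanSpace.norm_sq_eq, Real.norm_eq_abs, sq_abs]
  rw [Finset.sum_comm, Finset.sum_comm (s := Finset.univ) (f := fun i j => (y i j) ^ 2),
    Finset.mul_sum]
  refine Finset.sum_le_sum fun r _ => ?_
  have := sum_sq_mulVec_le_of_sum_eq_zero hA h1 (y := fun i => y i r)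
    (by simpa using congrArg (fun u : EuclideanSpace ℝ (Fin d) => u r) hy)
  simpa using this

/-! ### Zeros of strongly monotone gradients -/

section Monotone
variable {E : Type*} [NormedAddCommGroup E] [InnerProductSpace ℝ E] [CompleteSpace E]

/-- A Lipschitz and strongly monotone map has a zero: a small step along it is a contraction. -/
theorem exists_eq_zero_of_lipschitz_of_strongMono {F : E → E} {C c : ℝ} (hc : 0 < c)
    (hLip : ∀ x y, ‖F x - F y‖ ≤ C * ‖x - y‖)
    (hmono : ∀ x y, c * ‖x - y‖ ^ 2 ≤ inner ℝ (F x - F y) (x - y)) : ∃ x, F x = 0 := by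
  -- The step `t = c / (C ^ 2 + c ^ 2)` gives the contraction factor `√(1 - t * c)`.
  set t : ℝ := c / (C ^ 2 + c ^ 2) with ht
  have hden : 0 < C ^ 2 + c ^ 2 := by positivity
  have ht0 : 0 < t := by positivity
  have htc : t * (C ^ 2 + c ^ 2) = c := by rw [ht]; field_simp
  have hq0 : 0 ≤ 1 - t * c := by
    have : t * c ≤ 1 := by
      rw [ht, div_mul_eq_mul_div, div_le_one hden]; nlinarith [sq_nonneg C]
    linarith
  have hcontr : ContractingWith (√(1 - t * c)).toNNReal (fun x => x - t • F x) := by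
    refine ⟨?_, LipschitzWith.of_dist_le_mul fun x y => ?_⟩
    · rw [Real.toNNReal_lt_one, Real.sqrt_lt' one_pos]
      simpa using mul_pos ht0 hc
    · rw [dist_eq_norm, dist_eq_norm, Real.coe_toNNReal _ (Real.sqrt_nonneg _)]
      refine le_of_sq_le_sq ?_ (by positivity)
      rw [mul_pow, Real.sq_sqrt hq0]
      have h1 : x - t • F x - (y - t • F y) = (x - y) - t • (F x - F y) := by
        rw [smul_sub]; abel
      rw [h1, norm_sub_sq_real, norm_smul, inner_smul_right, Real.norm_of_nonneg ht0.le,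
        real_inner_comm]
      have h2 : ‖F x - F y‖ ^ 2 ≤ C ^ 2 * ‖x - y‖ ^ 2 := by
        rw [← mul_pow]; exact pow_le_pow_left₀ (norm_nonneg _) (hLip x y) 2
      have h3 := mul_le_mul_of_nonneg_left (hmono x y) ht0.le
      have h4 := mul_le_mul_of_nonneg_left h2 (sq_nonneg t)
      have h5 : t ^ 2 * C ^ 2 ≤ t * c := by
        nlinarith [mul_nonneg ht0.le (mul_nonneg ht0.le (sq_nonneg c))]
      have h6 := mul_le_mul_of_nonneg_right h5 (sq_nonneg ‖x - y‖)
      nlinarith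
  obtain ⟨x, hx, -⟩ := hcontr.exists_fixedPoint 0 (edist_ne_top _ _)
  refine ⟨x, ?_⟩
  have h : t • F x = 0 := by
    have : x - t • F x = x := hx
    simpa using this
  exact (smul_eq_zero.1 h).resolve_left ht0.ne'

/-- A zero of a monotone gradient is a global minimizer. -/
theorem sum_le_sum_of_sum_gradient_eq_zero {ι : Type*} [Fintype ι] {f : ι → E → ℝ}
    (hd : ∀ i, Differentiable ℝ (f i))
    (hmono : ∀ i x y, 0 ≤ inner ℝ (gradient (f i) x - gradient (f i) y) (x - y))
    {x : E} (hx : ∑ i, gradient (f i) x = 0) (y : E) : ∑ i, f i x ≤ ∑ i, f i y := by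
  set φ : ℝ → ℝ := fun t => ∑ i, f i (x + t • (y - x)) with hφ
  have hder : ∀ t, HasDerivAt φ (∑ i, inner ℝ (gradient (f i) (x + t • (y - x))) (y - x)) t := by
    intro t
    refine HasDerivAt.fun_sum fun i _ => ?_
    have h1 : HasDerivAt (fun t : ℝ => x + t • (y - x)) (y - x) t := by
      simpa using ((hasDerivAt_id t).smul_const (y - x)).const_add x
    have h2 := ((hd i) (x + t • (y - x))).hasGradientAt.hasFDerivAt.comp_hasDerivAt t h1
    simpa [Function.comp_def] using h2
  have hmonoφ : MonotoneOn φ (Set.Ici 0) := by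
    refine monotoneOn_of_deriv_nonneg (convex_Ici 0)
      (fun t _ => (hder t).continuousAt.continuousWithinAt)
      (fun t _ => (hder t).differentiableAt.differentiableWithinAt) fun t ht => ?_
    rw [interior_Ici, Set.mem_Ioi] at ht
    rw [(hder t).deriv]
    have h0 : ∑ i, inner ℝ (gradient (f i) x) (y - x) = 0 := by
      rw [← sum_inner, hx, inner_zero_left]
    rw [← h0, ← sub_nonneg, ← Finset.sum_sub_distrib]
    refine Finset.sum_nonneg fun i _ => ?_
    rw [← inner_sub_left]
    have := hmono i (x + t • (y - x)) x
    rw [add_sub_cancel_left, inner_smul_right] at this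
    exact nonneg_of_mul_nonneg_right this ht
  simpa [hφ] using hmonoφ (Set.mem_Ici.2 le_rfl) (Set.mem_Ici.2 zero_le_one) zero_le_one
end Monotone

/-! ### The Lyapunov function and its drift -/

noncomputable section Lyapunov

variable {n : ℕ} {E : Type*} [NormedAddCommGroup E] [InnerProductSpace ℝ E]

/-- The average of a family of `n` vectors, such as the agents' states or a batch of sampled
gradients; it is `0` for `n = 0`. -/
def agentMean (z : Fin n → E) : E := (n : ℝ)⁻¹ • ∑ i, z i

/-- The Lyapunov function: the squared norm of the average plus `c` times the squared
disagreement. -/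
def lyapunov (c : ℝ) (z : Fin n → E) : ℝ :=
  ‖agentMean z‖ ^ 2 + c * ∑ i, ‖z i - agentMean z‖ ^ 2

theorem agentMean_add (z w : Fin n → E) :
    agentMean (fun i => z i + w i) = agentMean z + agentMean w := by
  simp [agentMean, Finset.sum_add_distrib]

theorem agentMean_sub (z w : Fin n → E) :
    agentMean (fun i => z i - w i) = agentMean z - agentMean w := by
  simp [agentMean, Finset.sum_sub_distrib, smul_sub]

theorem agentMean_smul (a : ℝ) (z : Fin n → E) :
    agentMean (fun i => a • z i) = a • agentMean z := by
  simp [agentMean, ← Finset.smul_sum, smul_comm a]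

theorem agentMean_const (hn : n ≠ 0) (x : E) : agentMean (fun _ : Fin n => x) = x := by
  have : (n : ℝ) ≠ 0 := by exact_mod_cast hn
  simp [agentMean, ← Nat.cast_smul_eq_nsmul ℝ, smul_smul, this]

theorem agentMean_mix {A : Matrix (Fin n) (Fin n) ℝ} (hA : A ∈ doublyStochastic ℝ (Fin n))
    (z : Fin n → E) : agentMean (fun i => ∑ j, A i j • z j) = agentMean z := by
  unfold agentMean
  rw [Finset.sum_comm]
  simp [← Finset.sum_smul, sum_col_of_mem_doublyStochastic hA]

theorem sum_eq_smul_agentMean (z : Fin n → E) : ∑ i, z i = (n : ℝ) • agentMean z := by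
  rcases eq_or_ne n 0 with rfl | hn
  · simp
  · rw [agentMean, smul_smul, mul_inv_cancel₀ (by exact_mod_cast hn), one_smul]

theorem sum_sub_agentMean (z : Fin n → E) : ∑ i, (z i - agentMean z) = 0 := by
  rw [Finset.sum_sub_distrib, sum_eq_smul_agentMean]
  simp [← Nat.cast_smul_eq_nsmul ℝ]

theorem sum_norm_sq_eq (z : Fin n → E) :
    ∑ i, ‖z i‖ ^ 2 = n * ‖agentMean z‖ ^ 2 + ∑ i, ‖z i - agentMean z‖ ^ 2 := by
  have h : ∀ i, ‖z i‖ ^ 2 = ‖agentMean z‖ ^ 2 + 2 * inner ℝ (agentMean z) (z i - agentMean z)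
      + ‖z i - agentMean z‖ ^ 2 := fun i => by
    rw [← norm_add_sq_real, add_sub_cancel]
  rw [Finset.sum_congr rfl fun i _ => h i, Finset.sum_add_distrib, Finset.sum_add_distrib,
    ← Finset.mul_sum, ← inner_sum, sum_sub_agentMean]
  simp

theorem norm_agentMean_sq_le (z : Fin n → E) : n * ‖agentMean z‖ ^ 2 ≤ ∑ i, ‖z i‖ ^ 2 := by
  have : 0 ≤ ∑ i, ‖z i - agentMean z‖ ^ 2 := by positivity
  rw [sum_norm_sq_eq z]
  linarith

theorem sum_norm_sub_agentMean_sq_le (z : Fin n → E) :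
    ∑ i, ‖z i - agentMean z‖ ^ 2 ≤ ∑ i, ‖z i‖ ^ 2 := by
  have : 0 ≤ n * ‖agentMean z‖ ^ 2 := by positivity
  rw [sum_norm_sq_eq z]
  linarith

theorem lyapunov_nonneg {c : ℝ} (hc : 0 ≤ c) (z : Fin n → E) : 0 ≤ lyapunov c z := by
  unfold lyapunov; positivity

theorem lyapunov_le {c : ℝ} (hc : 0 ≤ c) (z : Fin n → E) :
    lyapunov c z ≤ (1 + c) * ∑ i, ‖z i‖ ^ 2 := by
  have h1 := sum_norm_sub_agentMean_sq_le z
  have h2 : ‖agentMean z‖ ^ 2 ≤ ∑ i, ‖z i‖ ^ 2 := by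
    rcases eq_or_ne n 0 with rfl | hn
    · simp [agentMean]
    · have h3 : (1 : ℝ) ≤ n := by exact_mod_cast Nat.one_le_iff_ne_zero.2 hn
      nlinarith [norm_agentMean_sq_le z, sq_nonneg ‖agentMean z‖]
  unfold lyapunov
  nlinarith

theorem norm_sq_le_lyapunov {c : ℝ} (hc : 1 ≤ c) (z : Fin n → E) (i : Fin n) :
    ‖z i‖ ^ 2 ≤ 2 * lyapunov c z := by
  have h1 : ‖z i - agentMean z‖ ^ 2 ≤ ∑ i, ‖z i - agentMean z‖ ^ 2 :=
    Finset.single_le_sum (f := fun i => ‖z i - agentMean z‖ ^ 2) (fun _ _ => sq_nonneg _)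
      (Finset.mem_univ i)
  have h2 : ‖z i‖ ≤ ‖agentMean z‖ + ‖z i - agentMean z‖ := by
    simpa using norm_add_le (agentMean z) (z i - agentMean z)
  have h3 : ‖z i‖ ^ 2 ≤ (‖agentMean z‖ + ‖z i - agentMean z‖) ^ 2 :=
    pow_le_pow_left₀ (norm_nonneg _) h2 2
  unfold lyapunov
  nlinarith [sq_nonneg (‖agentMean z‖ - ‖z i - agentMean z‖), sq_nonneg ‖z i - agentMean z‖]

/-- Half the gradient of `lyapunov c` at `z`, in the direction of agent `i`. -/
def lyapunovGrad (c : ℝ) (z : Fin n → E) (i : Fin n) : E :=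
  (n : ℝ)⁻¹ • agentMean z + c • (z i - agentMean z)

/-- Exact second-order expansion of the quadratic function `lyapunov c`. -/
theorem lyapunov_add (c : ℝ) (z w : Fin n → E) :
    lyapunov c (fun i => z i + w i)
      = lyapunov c z + 2 * ∑ i, inner ℝ (lyapunovGrad c z i) (w i) + lyapunov c w := by
  have h1 : ∑ i, inner ℝ (lyapunovGrad c z i) (w i)
      = inner ℝ (agentMean z) (agentMean w)
        + c * ∑ i, inner ℝ (z i - agentMean z) (w i - agentMean w) := by
    have h2 : ∑ i, inner ℝ (z i - agentMean z) (w i - agentMean w)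
        = ∑ i, inner ℝ (z i - agentMean z) (w i) := by
      simp only [inner_sub_right _ (w _)]
      rw [Finset.sum_sub_distrib, ← sum_inner, sum_sub_agentMean, inner_zero_left, sub_zero]
    rw [h2, Finset.mul_sum]
    nth_rewrite 2 [agentMean]
    rw [inner_smul_right, inner_sum, Finset.mul_sum, ← Finset.sum_add_distrib]
    simp [lyapunovGrad, inner_add_left, inner_smul_left]
  have h3 : ∑ i, ‖z i + w i - (agentMean z + agentMean w)‖ ^ 2
      = ∑ i, ‖z i - agentMean z‖ ^ 2 + 2 * ∑ i, inner ℝ (z i - agentMean z) (w i - agentMean w)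
        + ∑ i, ‖w i - agentMean w‖ ^ 2 := by
    rw [Finset.mul_sum, ← Finset.sum_add_distrib, ← Finset.sum_add_distrib]
    refine Finset.sum_congr rfl fun i _ => ?_
    rw [← norm_add_sq_real]; congr 2; abel
  rw [h1, lyapunov, agentMean_add, h3, norm_add_sq_real, lyapunov, lyapunov]
  ring

/-- Young's inequality for the square of a norm of a sum. -/
theorem norm_add_sq_le_weighted {F : Type*} [SeminormedAddCommGroup F] {s : ℝ} (hs : 0 < s)
    (a b : F) :
    ‖a + b‖ ^ 2 ≤ (1 + s) * ‖a‖ ^ 2 + (1 + s⁻¹) * ‖b‖ ^ 2 := by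
  have h1 : ‖a + b‖ ^ 2 ≤ (‖a‖ + ‖b‖) ^ 2 :=
    pow_le_pow_left₀ (norm_nonneg _) (norm_add_le a b) 2
  have h2 : 0 ≤ s⁻¹ * (s * ‖a‖ - ‖b‖) ^ 2 := by positivity
  have h3 : s⁻¹ * (s * ‖a‖ - ‖b‖) ^ 2 = s * ‖a‖ ^ 2 - 2 * ‖a‖ * ‖b‖ + s⁻¹ * ‖b‖ ^ 2 := by
    field_simp
    ring
  nlinarith

theorem norm_convexComb_sq_le {b : ℝ} (hb0 : 0 ≤ b) (hb1 : b ≤ 1) (x y : E) :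
    ‖(1 - b) • x + b • y‖ ^ 2 ≤ (1 - b) * ‖x‖ ^ 2 + b * ‖y‖ ^ 2 := by
  have h1 : ‖(1 - b) • x + b • y‖ ≤ (1 - b) * ‖x‖ + b * ‖y‖ := by
    refine (norm_add_le _ _).trans_eq ?_
    rw [norm_smul, norm_smul, Real.norm_of_nonneg hb0, Real.norm_of_nonneg (by linarith)]
  have h2 := pow_le_pow_left₀ (norm_nonneg _) h1 2
  nlinarith [mul_nonneg (mul_nonneg hb0 (sub_nonneg.2 hb1)) (sq_nonneg (‖x‖ - ‖y‖))]

variable {T : Fin n → E → E} {C m : ℝ} {p : E}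

omit [InnerProductSpace ℝ E] in
theorem norm_sub_sq_le_of_lipschitz (hLip : ∀ i x y, ‖T i x - T i y‖ ≤ C * ‖x - y‖) (i : Fin n)
    (x y : E) : ‖T i x - T i y‖ ^ 2 ≤ C ^ 2 * ‖x - y‖ ^ 2 := by
  rw [← mul_pow]
  exact pow_le_pow_left₀ (norm_nonneg _) (hLip i x y) 2

theorem agentMean_eq_agentMean_sub (hp : ∑ i, T i p = 0) (x : Fin n → E) :
    agentMean (fun i => T i (x i)) = agentMean (fun i => T i (x i) - T i p) := by
  rw [agentMean_sub]
  nth_rewrite 3 [agentMean]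
  rw [hp, smul_zero, sub_zero]

/-- The average gradient points away from the zero of the total gradient, up to the
disagreement. -/
theorem le_inner_agentMean (hn : n ≠ 0) (hm : 0 < m)
    (hLip : ∀ i x y, ‖T i x - T i y‖ ≤ C * ‖x - y‖)
    (hmono : ∀ i x y, m * ‖x - y‖ ^ 2 ≤ inner ℝ (T i x - T i y) (x - y))
    (hp : ∑ i, T i p = 0) (z : Fin n → E) :
    m / 2 * ‖agentMean z‖ ^ 2 - C ^ 2 / (2 * m) * ∑ i, ‖z i - agentMean z‖ ^ 2
      ≤ inner ℝ (agentMean fun i => T i (z i + p)) (agentMean z) := by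
  have hn1 : (1 : ℝ) ≤ n := by exact_mod_cast Nat.one_le_iff_ne_zero.2 hn
  have h1 : ∀ i, m / 2 * ‖agentMean z‖ ^ 2 - C ^ 2 / (2 * m) * ‖z i - agentMean z‖ ^ 2
      ≤ inner ℝ (T i (z i + p) - T i p) (agentMean z) := by
    intro i
    have h2 := hmono i (agentMean z + p) p
    rw [add_sub_cancel_right] at h2
    have h3 := hLip i (z i + p) (agentMean z + p)
    rw [add_sub_add_right_eq_sub] at h3
    have h4 := neg_le_of_abs_le (abs_real_inner_le_norm
      (T i (z i + p) - T i (agentMean z + p)) (agentMean z))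
    have h5 : inner ℝ (T i (z i + p) - T i p) (agentMean z)
        = inner ℝ (T i (z i + p) - T i (agentMean z + p)) (agentMean z)
          + inner ℝ (T i (agentMean z + p) - T i p) (agentMean z) := by
      rw [← inner_add_left]; congr 1; abel
    have h6 := mul_le_mul_of_nonneg_right h3 (norm_nonneg (agentMean z))
    have h7 : m / 2 * ‖agentMean z‖ ^ 2 + C ^ 2 / (2 * m) * ‖z i - agentMean z‖ ^ 2
        - C * ‖z i - agentMean z‖ * ‖agentMean z‖
        = (2 * m)⁻¹ * (m * ‖agentMean z‖ - C * ‖z i - agentMean z‖) ^ 2 := by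
      field_simp; ring
    have h8 : 0 ≤ (2 * m)⁻¹ * (m * ‖agentMean z‖ - C * ‖z i - agentMean z‖) ^ 2 := by positivity
    linarith
  have h3 := Finset.sum_le_sum fun i (_ : i ∈ Finset.univ) => h1 i
  rw [← sum_inner, sum_eq_smul_agentMean (fun i => T i (z i + p) - T i p),
    ← agentMean_eq_agentMean_sub hp (fun i => z i + p), inner_smul_left, Finset.sum_sub_distrib,
    ← Finset.mul_sum] at h3
  simp only [Finset.sum_const, Finset.card_univ, Fintype.card_fin, nsmul_eq_mul,
    conj_trivial] at h3
  rw [← Finset.mul_sum] at h3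
  have h4 : 0 ≤ C ^ 2 / (2 * m) * ∑ i, ‖z i - agentMean z‖ ^ 2 := by positivity
  have h5 : 0 ≤ (n : ℝ) * (inner ℝ (agentMean fun i => T i (z i + p)) (agentMean z)
      - (m / 2 * ‖agentMean z‖ ^ 2 - C ^ 2 / (2 * m) * ∑ i, ‖z i - agentMean z‖ ^ 2)) := by
    nlinarith
  have h6 := nonneg_of_mul_nonneg_right h5 (by linarith)
  linarith

/-- Effect of one gradient step on the squared norm `V` of the average, for disagreement `U`. -/
theorem agentMean_drift_le (hn : n ≠ 0) (hm : 0 < m)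
    (hLip : ∀ i x y, ‖T i x - T i y‖ ≤ C * ‖x - y‖)
    (hmono : ∀ i x y, m * ‖x - y‖ ^ 2 ≤ inner ℝ (T i x - T i y) (x - y))
    (hp : ∑ i, T i p = 0) {a : ℝ} (ha : 0 ≤ a) (z : Fin n → E) {V U : ℝ}
    (hV : V = ‖agentMean z‖ ^ 2) (hU : U = ∑ i, ‖z i - agentMean z‖ ^ 2) :
    ‖agentMean z - a • agentMean fun i => T i (z i + p)‖ ^ 2
      ≤ V - m * a * V + C ^ 2 / m * a * U + a ^ 2 * (C ^ 2 * (V + U)) := by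
  have hn1 : (1 : ℝ) ≤ n := by exact_mod_cast Nat.one_le_iff_ne_zero.2 hn
  have hU0 : 0 ≤ U := by rw [hU]; positivity
  have hzn := sum_norm_sq_eq z
  rw [← hV, ← hU] at hzn
  have hin := le_inner_agentMean hn hm hLip hmono hp z
  rw [← hV, ← hU] at hin
  have hG : ‖agentMean fun i => T i (z i + p)‖ ^ 2 ≤ C ^ 2 * (V + U) := by
    have h1 := norm_agentMean_sq_le (fun i => T i (z i + p) - T i p)
    rw [← agentMean_eq_agentMean_sub hp (fun i => z i + p)] at h1
    have h2 := Finset.sum_le_sum fun i (_ : i ∈ Finset.univ) =>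
      norm_sub_sq_le_of_lipschitz hLip i (z i + p) p
    simp only [add_sub_cancel_right] at h2
    rw [← Finset.mul_sum, hzn] at h2
    have h3 : 0 ≤ (n : ℝ) * (C ^ 2 * (V + U) - ‖agentMean fun i => T i (z i + p)‖ ^ 2) := by
      nlinarith [mul_nonneg (sub_nonneg.2 hn1) (mul_nonneg (sq_nonneg C) hU0)]
    have h4 := nonneg_of_mul_nonneg_right h3 (by linarith)
    linarith
  rw [norm_sub_sq_real, inner_smul_right, norm_smul, Real.norm_of_nonneg ha, mul_pow,
    real_inner_comm, ← hV]
  have h1 := mul_le_mul_of_nonneg_left hin ha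
  have h2 := mul_le_mul_of_nonneg_left hG (sq_nonneg a)
  have h3 : a * (m / 2 * V - C ^ 2 / (2 * m) * U) * 2 = m * a * V - C ^ 2 / m * a * U := by
    field_simp
  linarith

theorem sum_norm_sub_agentMean_gradient_le (hLip : ∀ i x y, ‖T i x - T i y‖ ≤ C * ‖x - y‖)
    (z : Fin n → E) {G : Fin n → E} (hG : ∀ i, G i = T i (z i + p)) :
    ∑ i, ‖G i - agentMean G‖ ^ 2
      ≤ 2 * C ^ 2 * ∑ i, ‖z i‖ ^ 2 + 2 * ∑ i, ‖T i p‖ ^ 2 := by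
  refine (sum_norm_sub_agentMean_sq_le G).trans ?_
  rw [Finset.mul_sum, Finset.mul_sum, ← Finset.sum_add_distrib]
  refine Finset.sum_le_sum fun i _ => ?_
  have h1 := norm_add_sq_le_weighted one_pos (T i (z i + p) - T i p) (T i p)
  have h2 := norm_sub_sq_le_of_lipschitz hLip i (z i + p) p
  rw [sub_add_cancel] at h1
  rw [add_sub_cancel_right] at h2
  rw [hG i]
  norm_num at h1
  linarith

end Lyapunov

/-- One step of mixing and of moving along `G` shrinks the disagreement of `z`: on vectors with
mean zero, `A` contracts by its second singular value `s`. -/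
theorem disagreement_drift_le {n d : ℕ} {A : Matrix (Fin n) (Fin n) ℝ}
    (hA : A ∈ doublyStochastic ℝ (Fin n)) {s : ℝ} (hs : s = secondSingularValue A) (hs1 : s < 1)
    {a b : ℝ} (hb0 : 0 < b) (hb1 : b < 1) (z G : Fin n → EuclideanSpace ℝ (Fin d)) :
    ∑ i, ‖((1 - b) • z i + b • ∑ j, A i j • z j) - a • G i
        - (agentMean z - a • agentMean G)‖ ^ 2
      ≤ (1 - (1 - s) * b / 2) * ∑ i, ‖z i - agentMean z‖ ^ 2
        + (1 + 2 / (1 - s)) * (a ^ 2 / b) * ∑ i, ‖G i - agentMean G‖ ^ 2 := by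
  have hs0 : 0 ≤ s := hs ▸ LinearMap.singularValues_nonneg _ 1
  have hκ : 0 < 1 - s := by linarith
  obtain ⟨y, hy⟩ : ∃ y, y = fun i => z i - agentMean z := ⟨_, rfl⟩
  have hyi : ∀ i, z i - agentMean z = y i := fun i => by rw [hy]
  have hy0 : ∑ i, y i = 0 := by rw [hy]; exact sum_sub_agentMean z
  simp only [hyi]
  obtain ⟨U, hU⟩ : ∃ U, U = ∑ i, ‖y i‖ ^ 2 := ⟨_, rfl⟩
  have hU0 : 0 ≤ U := by rw [hU]; positivity
  obtain ⟨R, hR⟩ : ∃ R, R = ∑ i, ‖G i - agentMean G‖ ^ 2 := ⟨_, rfl⟩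
  have hR0 : 0 ≤ R := by rw [hR]; positivity
  have hUmix : ∑ i, ‖(1 - b) • y i + b • ∑ j, A i j • y j‖ ^ 2 ≤ (1 - (1 - s) * b) * U := by
    have h1 := Finset.sum_le_sum fun i (_ : i ∈ Finset.univ) =>
      norm_convexComb_sq_le hb0.le hb1.le (y i) (∑ j, A i j • y j)
    rw [Finset.sum_add_distrib, ← Finset.mul_sum, ← Finset.mul_sum, ← hU] at h1
    have h2 := sum_norm_sq_mix_le hA (hs ▸ hs1) hy0
    rw [← hs, ← hU] at h2
    have h4 : s ^ 2 * U ≤ s * U := mul_le_mul_of_nonneg_right (by nlinarith) hU0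
    have h5 := mul_le_mul_of_nonneg_left (h2.trans h4) hb0.le
    linarith
  -- Young's inequality with this weight gives away half of the contraction to the step along `G`
  obtain ⟨t, ht⟩ : ∃ t, t = (1 - s) * b / 2 := ⟨_, rfl⟩
  have ht0 : 0 < t := by rw [ht]; positivity
  have h1 : ∀ i, ((1 - b) • z i + b • ∑ j, A i j • z j) - a • G i
      - (agentMean z - a • agentMean G)
      = ((1 - b) • y i + b • ∑ j, A i j • y j) + (-a) • (G i - agentMean G) := by
    intro i
    have h2 : ∑ j, A i j • y j = ∑ j, A i j • z j - agentMean z := by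
      simp only [hy, smul_sub, Finset.sum_sub_distrib, ← Finset.sum_smul]
      rw [sum_row_of_mem_doublyStochastic hA, one_smul]
    rw [h2, hy]; module
  have h3 := Finset.sum_le_sum fun i (_ : i ∈ Finset.univ) => norm_add_sq_le_weighted ht0
    ((1 - b) • y i + b • ∑ j, A i j • y j) ((-a) • (G i - agentMean G))
  simp only [h1]
  refine h3.trans ?_
  rw [Finset.sum_add_distrib, ← Finset.mul_sum, ← Finset.mul_sum]
  simp only [norm_smul, mul_pow, norm_neg, Real.norm_eq_abs, sq_abs]
  rw [← Finset.mul_sum, ← hU, ← hR, ← ht]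
  refine add_le_add ?_ ?_
  · refine (mul_le_mul_of_nonneg_left hUmix (by linarith)).trans ?_
    rw [← mul_assoc]
    refine mul_le_mul_of_nonneg_right ?_ hU0
    nlinarith
  · rw [← mul_assoc]
    refine mul_le_mul_of_nonneg_right ?_ hR0
    have h4 : (1 + 2 / (1 - s)) * (a ^ 2 / b) - (1 + t⁻¹) * a ^ 2 = a ^ 2 * ((1 - b) / b) := by
      rw [ht]; field_simp; ring
    have h5 : 0 ≤ a ^ 2 * ((1 - b) / b) :=
      mul_nonneg (sq_nonneg _) (div_nonneg (by linarith) hb0.le)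
    linarith

/-- The scalar inequality behind the drift estimate: `V` and `U` are the squared norms of the
average and of the disagreement, `V'` and `U'` those after the step. -/
theorem drift_combine {N s m C a b c K V U V' U' R B : ℝ} (hn1 : 1 ≤ N) (hs1 : s < 1) (hm : 0 < m)
    (ha : 0 < a) (hb0 : 0 < b) (hb1 : b < 1) (hab : 3 * m * a ≤ 2 * (1 - s) * b)
    (hc : c = 1 + 4 * C ^ 2 / m ^ 2)
    (hK : K = C ^ 2 + c * ((1 + 2 / (1 - s)) * (2 * C ^ 2 * N + 2 * B)))
    (hV0 : 0 ≤ V) (hU0 : 0 ≤ U) (hB0 : 0 ≤ B)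
    (h1 : U' ≤ (1 - (1 - s) * b / 2) * U + (1 + 2 / (1 - s)) * (a ^ 2 / b) * R)
    (h2 : R ≤ 2 * C ^ 2 * (N * V + U) + 2 * B)
    (h3 : V' ≤ V - m * a * V + C ^ 2 / m * a * U + a ^ 2 * (C ^ 2 * (V + U))) :
    V' + c * U' ≤ (1 - m / 2 * a + K * (a ^ 2 / b)) * (V + c * U) + K * (a ^ 2 / b) := by
  have hκ : 0 < 1 - s := by linarith
  have hη : a ^ 2 ≤ a ^ 2 / b := by
    rw [le_div_iff₀ hb0]; nlinarith [sq_nonneg a]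
  have hc1 : 1 ≤ c := by
    have : 0 ≤ 4 * C ^ 2 / m ^ 2 := by positivity
    linarith
  have hc0 : 0 ≤ c := by linarith
  obtain ⟨e, he⟩ : ∃ e, e = a ^ 2 / b := ⟨_, rfl⟩
  have he0 : 0 ≤ e := by rw [he]; positivity
  obtain ⟨Q, hQ⟩ : ∃ Q, Q = 1 + 2 / (1 - s) := ⟨_, rfl⟩
  have hQ0 : 0 ≤ Q := by rw [hQ]; positivity
  rw [← he] at hη ⊢ h1
  rw [← hQ] at hK h1
  have hUc : U ≤ c * U := by nlinarith
  have h4 : a ^ 2 * (C ^ 2 * (V + U)) ≤ e * (C ^ 2 * (V + c * U)) := by gcongr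
  have h5 : Q * e * R
      ≤ Q * e * ((2 * C ^ 2 * N + 2 * B) * (V + c * U) + (2 * C ^ 2 * N + 2 * B)) := by
    refine mul_le_mul_of_nonneg_left (h2.trans ?_) (by positivity)
    have h6 : N * V + U ≤ N * (V + c * U) := by
      nlinarith [mul_nonneg (sub_nonneg.2 hn1) (mul_nonneg hc0 hU0)]
    have h7 := mul_le_mul_of_nonneg_left h6 (by positivity : 0 ≤ 2 * C ^ 2)
    have h8 : 0 ≤ 2 * B * (V + c * U) := by positivity
    have h9 : 0 ≤ 2 * C ^ 2 * N := by positivity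
    linarith
  have h6 := mul_le_mul_of_nonneg_left (h1.trans (add_le_add_right h5 _)) hc0
  -- the disagreement in the drift of the average is absorbed
  have h7 : C ^ 2 / m * a ≤ c * ((1 - s) * b / 2 - m / 2 * a) := by
    have h8 : m * a / 4 ≤ (1 - s) * b / 2 - m / 2 * a := by linarith
    have h9 : C ^ 2 / m * a = 4 * C ^ 2 / m ^ 2 * (m * a / 4) := by field_simp
    rw [h9]
    exact mul_le_mul (by linarith) h8 (by positivity) hc0
  have h8 := mul_le_mul_of_nonneg_right h7 hU0
  have h9 : 0 ≤ m / 2 * a * V := by positivity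
  have h10 : 0 ≤ C ^ 2 * e := by positivity
  rw [hK]
  linarith

/-- One step of the noiseless algorithm contracts the Lyapunov function, up to an error of
order `a ^ 2 / b`. The weight `1 + 4 C ^ 2 / m ^ 2` of the disagreement makes its contraction
(of rate `b (1 - s)`) absorb the effect of the disagreement on the average gradient. -/
theorem lyapunov_drift_le {n d : ℕ} (hn : n ≠ 0) {A : Matrix (Fin n) (Fin n) ℝ}
    (hA : A ∈ doublyStochastic ℝ (Fin n)) {s : ℝ} (hs : s = secondSingularValue A) (hs1 : s < 1)
    {T : Fin n → EuclideanSpace ℝ (Fin d) → EuclideanSpace ℝ (Fin d)} {C m : ℝ} (hm : 0 < m)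
    (hLip : ∀ i x y, ‖T i x - T i y‖ ≤ C * ‖x - y‖)
    (hmono : ∀ i x y, m * ‖x - y‖ ^ 2 ≤ inner ℝ (T i x - T i y) (x - y))
    {p : EuclideanSpace ℝ (Fin d)} (hp : ∑ i, T i p = 0)
    {a b : ℝ} (ha : 0 < a) (hb0 : 0 < b) (hb1 : b < 1) (hab : 3 * m * a ≤ 2 * (1 - s) * b)
    {c : ℝ} (hc : c = 1 + 4 * C ^ 2 / m ^ 2)
    {K : ℝ} (hK : K = C ^ 2 + c * ((1 + 2 / (1 - s)) *
      (2 * C ^ 2 * n + 2 * ∑ i, ‖T i p‖ ^ 2)))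
    (x : Fin n → EuclideanSpace ℝ (Fin d)) :
    lyapunov c (fun i => (1 - b) • x i + b • ∑ j, A i j • x j - a • T i (x i) - p)
      ≤ (1 - m / 2 * a + K * (a ^ 2 / b)) * lyapunov c (fun i => x i - p)
        + K * (a ^ 2 / b) := by
  have hn1 : (1 : ℝ) ≤ n := by exact_mod_cast Nat.one_le_iff_ne_zero.2 hn
  obtain ⟨z, hz⟩ : ∃ z, z = fun i => x i - p := ⟨_, rfl⟩
  have hxz : ∀ i, x i = z i + p := fun i => by rw [hz]; simp
  have hw : (fun i => (1 - b) • x i + b • ∑ j, A i j • x j - a • T i (x i) - p)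
      = fun i => ((1 - b) • z i + b • ∑ j, A i j • z j) - a • T i (z i + p) := by
    funext i
    have h1 : ∑ j, A i j • x j = ∑ j, A i j • z j + p := by
      simp only [hxz, smul_add, Finset.sum_add_distrib, ← Finset.sum_smul]
      rw [sum_row_of_mem_doublyStochastic hA, one_smul]
    rw [h1, hxz i]
    module
  rw [hw, ← hz]
  obtain ⟨G, hG⟩ : ∃ G, G = fun i => T i (z i + p) := ⟨_, rfl⟩
  have hGi : ∀ i, G i = T i (z i + p) := fun i => by rw [hG]
  simp only [← hGi]
  have hmean : agentMean (fun i => ((1 - b) • z i + b • ∑ j, A i j • z j) - a • G i)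
      = agentMean z - a • agentMean G := by
    rw [agentMean_sub, agentMean_add, agentMean_smul, agentMean_smul, agentMean_smul,
      agentMean_mix hA]
    module
  unfold lyapunov
  rw [hmean]
  have h1 := disagreement_drift_le (a := a) hA hs hs1 hb0 hb1 z G
  have h2 := sum_norm_sub_agentMean_gradient_le hLip z hGi
  rw [sum_norm_sq_eq z] at h2
  generalize (∑ i, ‖((1 - b) • z i + b • ∑ j, A i j • z j) - a • G i
        - (agentMean z - a • agentMean G)‖ ^ 2) = U' at *
  have h3 := agentMean_drift_le hn hm hLip hmono hp ha.le z rfl rfl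
  rw [← hG] at h3
  exact drift_combine hn1 hs1 hm ha hb0 hb1 hab hc hK (sq_nonneg _)
    (Finset.sum_nonneg fun _ _ => sq_nonneg _) (Finset.sum_nonneg fun _ _ => sq_nonneg _) h1 h2 h3

/-! ### Almost supermartingales -/

/-- The recursion forces `∑ a k * w k < ∞` and the convergence of `w`; as `∑ a k = ∞`, the limit
is `0`. -/
theorem tendsto_zero_of_le_sub_mul_add {w a δ : ℕ → ℝ} (hw : ∀ k, 0 ≤ w k) (ha : ∀ k, 0 ≤ a k)
    (hδ : ∀ k, 0 ≤ δ k) (hδs : Summable δ)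
    (hdiv : Tendsto (fun K => ∑ k ∈ Finset.range K, a k) atTop atTop)
    (hrec : ∀ k, w (k + 1) ≤ w k - a k * w k + δ k) : Tendsto w atTop (𝓝 0) := by
  set u : ℕ → ℝ := fun k =>
    w k + ∑ j ∈ Finset.range k, a j * w j - ∑ j ∈ Finset.range k, δ j with hu
  have hanti : Antitone u := antitone_nat_of_succ_le fun k => by
    simp only [hu, Finset.sum_range_succ]
    linarith [hrec k]
  have hD : ∀ k, ∑ j ∈ Finset.range k, δ j ≤ ∑' j, δ j := fun k =>
    hδs.sum_le_tsum _ fun j _ => hδ j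
  have hS : ∀ k, 0 ≤ ∑ j ∈ Finset.range k, a j * w j := fun k =>
    Finset.sum_nonneg fun j _ => mul_nonneg (ha j) (hw j)
  have hu0 : u 0 = w 0 := by simp [hu]
  have hbdd : BddBelow (Set.range u) := ⟨-∑' j, δ j, by
    rintro _ ⟨k, rfl⟩
    simp only [hu]
    linarith [hD k, hS k, hw k]⟩
  have hsum : Summable fun j => a j * w j := by
    refine summable_of_sum_range_le (c := w 0 + ∑' j, δ j)
      (fun j => mul_nonneg (ha j) (hw j)) fun k => ?_
    have h1 := hanti (Nat.zero_le k)
    rw [hu0] at h1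
    simp only [hu] at h1
    linarith [hD k, hw k]
  have hlim := ((tendsto_atTop_ciInf hanti hbdd).sub hsum.hasSum.tendsto_sum_nat).add
    hδs.hasSum.tendsto_sum_nat
  set l := (⨅ i, u i) - ∑' j, a j * w j + ∑' j, δ j
  have hwl : Tendsto w atTop (𝓝 l) := by
    refine hlim.congr fun k => ?_
    simp only [hu]; ring
  have hl0 : 0 ≤ l := ge_of_tendsto' hwl hw
  rcases hl0.eq_or_lt with hl | hl
  · rwa [← hl] at hwl
  · exfalso
    have hev : ∀ᶠ k in atTop, l / 2 ≤ w k :=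
      (hwl.eventually_const_le (by linarith : l / 2 < l))
    have hsa : Summable a := by
      refine Summable.of_norm_bounded_eventually_nat (hsum.mul_left (2 / l)) ?_
      filter_upwards [hev] with k hk
      rw [Real.norm_of_nonneg (ha k)]
      calc a k = 2 / l * (a k * (l / 2)) := by field_simp
        _ ≤ 2 / l * (a k * w k) := by have := ha k; gcongr
    exact not_tendsto_atTop_of_tendsto_nhds hsa.hasSum.tendsto_sum_nat hdiv

section Probability
variable {Ω : Type*} {m0 : MeasurableSpace Ω} {P : Measure Ω} [IsProbabilityMeasure P]

/-- The case of `robbins_siegmund` without a growing factor. Subtracting the sums of `δ` gives an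
`L¹`-bounded supermartingale, and the recursion for the means identifies its limit. -/
theorem ae_tendsto_zero_of_setIntegral_le {F : Filtration ℕ m0} {W : ℕ → Ω → ℝ}
    (hadp : StronglyAdapted F W) (hint : ∀ k, Integrable (W k) P) (hW : ∀ k ω, 0 ≤ W k ω)
    {a δ : ℕ → ℝ} (ha : ∀ k, 0 ≤ a k) (hδ : ∀ k, 0 ≤ δ k) (hδs : Summable δ)
    (hdiv : Tendsto (fun K => ∑ k ∈ Finset.range K, a k) atTop atTop)
    (hrec : ∀ k s, MeasurableSet[F k] s →
      ∫ ω in s, W (k + 1) ω ∂P ≤ (1 - a k) * ∫ ω in s, W k ω ∂P + δ k * P.real s) :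
    Tendsto (fun k => ∫ ω, W k ω ∂P) atTop (𝓝 0) ∧
      ∀ᵐ ω ∂P, Tendsto (fun k => W k ω) atTop (𝓝 0) := by
  have hmean : Tendsto (fun k => ∫ ω, W k ω ∂P) atTop (𝓝 0) := by
    refine tendsto_zero_of_le_sub_mul_add (fun k => integral_nonneg (hW k)) ha hδ hδs hdiv
      fun k => ?_
    have := hrec k Set.univ MeasurableSet.univ
    simp only [Measure.restrict_univ, probReal_univ] at this
    linarith
  refine ⟨hmean, ?_⟩
  set Y : ℕ → Ω → ℝ := fun k ω => W k ω - ∑ j ∈ Finset.range k, δ j with hY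
  have hYint : ∀ k, Integrable (Y k) P := fun k => (hint k).sub (integrable_const _)
  have hsuper : Supermartingale Y F P := by
    refine supermartingale_of_setIntegral_succ_le
      (fun k => (hadp k).sub stronglyMeasurable_const) hYint fun k s hs => ?_
    simp only [hY]
    rw [integral_sub (hint _).integrableOn (integrable_const _),
      integral_sub (hint _).integrableOn (integrable_const _)]
    simp only [integral_const, smul_eq_mul, Finset.sum_range_succ, measureReal_restrict_apply_univ]
    have h1 := hrec k s hs
    have h2 : 0 ≤ a k * ∫ ω in s, W k ω ∂P :=
      mul_nonneg (ha k) (integral_nonneg fun ω => hW k ω)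
    linarith
  obtain ⟨B, hB⟩ := hmean.bddAbove_range
  have hbdd : ∀ k, eLpNorm ((-Y) k) 1 P ≤ ((B + ∑' j, δ j).toNNReal : NNReal) := by
    intro k
    have hneg : Integrable ((-Y) k) P := (hYint k).neg
    rw [eLpNorm_one_eq_lintegral_enorm, ← ofReal_integral_norm_eq_lintegral_enorm hneg]
    refine ENNReal.ofReal_le_ofReal ?_
    calc ∫ ω, ‖(-Y) k ω‖ ∂P ≤ ∫ ω, (W k ω + ∑' j, δ j) ∂P := by
          refine integral_mono hneg.norm ((hint k).add (integrable_const _)) fun ω => ?_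
          have h1 : ∑ j ∈ Finset.range k, δ j ≤ ∑' j, δ j := hδs.sum_le_tsum _ fun j _ => hδ j
          have h2 : 0 ≤ ∑ j ∈ Finset.range k, δ j := Finset.sum_nonneg fun j _ => hδ j
          simp only [Pi.neg_apply, norm_neg, hY, Real.norm_eq_abs]
          rw [abs_le]
          constructor <;> linarith [hW k ω]
      _ = ∫ ω, W k ω ∂P + ∑' j, δ j := by
          rw [integral_add (hint k) (integrable_const _)]; simp
      _ ≤ B + ∑' j, δ j := by
          have := hB (Set.mem_range_self k)
          linarith
  have hconv := hsuper.neg.exists_ae_tendsto_of_bdd hbdd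
  -- the limit vanishes because a subsequence tends to zero almost everywhere
  have hinm : TendstoInMeasure P W atTop 0 := by
    refine tendstoInMeasure_of_tendsto_eLpNorm one_ne_zero
      (fun k => (hint k).aestronglyMeasurable) aestronglyMeasurable_zero ?_
    have h1 : ∀ k, eLpNorm (W k - 0) 1 P = ENNReal.ofReal (∫ ω, W k ω ∂P) := by
      intro k
      rw [sub_zero, eLpNorm_one_eq_lintegral_enorm,
        ← ofReal_integral_norm_eq_lintegral_enorm (hint k)]
      simp only [Real.norm_of_nonneg (hW k _)]
    simp only [h1]
    simpa using ENNReal.tendsto_ofReal hmean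
  obtain ⟨ns, hns, hsub⟩ := hinm.exists_seq_tendsto_ae
  filter_upwards [hconv, hsub] with ω hω hω'
  obtain ⟨c, hc⟩ := hω
  have h1 : Tendsto (fun k => W k ω) atTop (𝓝 (∑' j, δ j - c)) := by
    refine (hδs.hasSum.tendsto_sum_nat.sub hc).congr fun k => ?_
    simp [hY]
  rwa [tendsto_nhds_unique (h1.comp hns.tendsto_atTop) hω'] at h1

/-- Robbins–Siegmund theorem with a vanishing limit, the conditional expectation being expressed
by integrals over the sets of the filtration. -/
theorem robbins_siegmund {F : Filtration ℕ m0} {W : ℕ → Ω → ℝ}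
    (hadp : StronglyAdapted F W) (hint : ∀ k, Integrable (W k) P) (hW : ∀ k ω, 0 ≤ W k ω)
    {a e δ : ℕ → ℝ} (ha : ∀ k, 0 ≤ a k) (he : ∀ k, 0 ≤ e k) (hes : Summable e)
    (hδ : ∀ k, 0 ≤ δ k) (hδs : Summable δ)
    (hdiv : Tendsto (fun K => ∑ k ∈ Finset.range K, a k) atTop atTop)
    (hrec : ∀ k s, MeasurableSet[F k] s →
      ∫ ω in s, W (k + 1) ω ∂P ≤ (1 - a k + e k) * ∫ ω in s, W k ω ∂P + δ k * P.real s) :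
    Tendsto (fun k => ∫ ω, W k ω ∂P) atTop (𝓝 0) ∧
      ∀ᵐ ω ∂P, Tendsto (fun k => W k ω) atTop (𝓝 0) := by
  -- normalize by the products `p k`, which stay between `1` and `M`
  set p : ℕ → ℝ := fun k => ∏ j ∈ Finset.range k, (1 + e j) with hp
  set M := Real.exp (∑' j, e j) with hM
  have hM0 : 0 < M := Real.exp_pos _
  have hp1 : ∀ k, 1 ≤ p k := fun k => Finset.one_le_prod fun j _ => by linarith [he j]
  have hpM : ∀ k, p k ≤ M := by
    intro k
    calc p k ≤ ∏ j ∈ Finset.range k, Real.exp (e j) := by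
          refine Finset.prod_le_prod (fun j _ => by linarith [he j]) fun j _ => ?_
          linarith [Real.add_one_le_exp (e j)]
      _ = Real.exp (∑ j ∈ Finset.range k, e j) := (Real.exp_sum _ _).symm
      _ ≤ M := Real.exp_le_exp.2 (hes.sum_le_tsum _ fun j _ => he j)
  have hp0 : ∀ k, 0 < p k := fun k => zero_lt_one.trans_le (hp1 k)
  have hpsucc : ∀ k, p (k + 1) = p k * (1 + e k) := fun k => Finset.prod_range_succ _ _
  have hdiv' : Tendsto (fun K => ∑ k ∈ Finset.range K, a k / M) atTop atTop := by
    simp only [← Finset.sum_div]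
    exact hdiv.atTop_div_const hM0
  have key := ae_tendsto_zero_of_setIntegral_le (P := P) (F := F) (W := fun k ω => (p k)⁻¹ * W k ω)
    (fun k => (hadp k).const_mul _) (fun k => (hint k).const_mul _)
    (fun k ω => mul_nonneg (inv_nonneg.2 (hp0 k).le) (hW k ω))
    (a := fun k => a k / M) (fun k => div_nonneg (ha k) hM0.le) hδ hδs hdiv' ?_
  · have hle : ∀ k x, 0 ≤ x → x ≤ M * ((p k)⁻¹ * x) := fun k x hx => by
      rw [← mul_assoc, ← div_eq_mul_inv]
      exact le_mul_of_one_le_left hx ((one_le_div (hp0 k)).2 (hpM k))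
    constructor
    · refine squeeze_zero (fun k => integral_nonneg (hW k))
        (fun k => hle k _ (integral_nonneg (hW k))) ?_
      have := key.1.const_mul M
      simpa only [integral_const_mul, mul_zero] using this
    · filter_upwards [key.2] with ω hω
      refine squeeze_zero (fun k => hW k ω) (fun k => hle k _ (hW k ω)) ?_
      simpa only [mul_zero] using hω.const_mul M
  · intro k s hs
    rw [integral_const_mul, integral_const_mul]
    have h1 := hrec k s hs
    set w := ∫ ω in s, W k ω ∂P
    have hw : 0 ≤ w := integral_nonneg fun ω => hW k ω
    have hps : 0 ≤ δ k * P.real s := mul_nonneg (hδ k) measureReal_nonneg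
    have h2 := mul_le_mul_of_nonneg_left h1 (inv_nonneg.2 (hp0 (k + 1)).le)
    refine h2.trans ?_
    have h3 : (p (k + 1))⁻¹ * ((1 - a k + e k) * w + δ k * P.real s)
        = (p k)⁻¹ * w - a k * w * (p (k + 1))⁻¹ + (p (k + 1))⁻¹ * (δ k * P.real s) := by
      have := (hp0 k).ne'
      have h4 : 1 + e k ≠ 0 := by linarith [he k]
      rw [hpsucc]; field_simp; ring
    rw [h3]
    have h4 : (p (k + 1))⁻¹ * (δ k * P.real s) ≤ δ k * P.real s :=
      mul_le_of_le_one_left hps (inv_le_one_of_one_le₀ (hp1 _))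
    have h5 : a k / M * ((p k)⁻¹ * w) ≤ a k * w * (p (k + 1))⁻¹ := by
      have h6 : (p k)⁻¹ * w ≤ w := mul_le_of_le_one_left hw (inv_le_one_of_one_le₀ (hp1 _))
      have h7 : M⁻¹ ≤ (p (k + 1))⁻¹ := inv_anti₀ (hp0 _) (hpM _)
      have h8 : 0 ≤ M⁻¹ := inv_nonneg.2 hM0.le
      calc a k / M * ((p k)⁻¹ * w) = a k * ((p k)⁻¹ * w) * M⁻¹ := by
            rw [div_eq_mul_inv]; ring
        _ ≤ a k * w * (p (k + 1))⁻¹ := by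
            refine mul_le_mul (mul_le_mul_of_nonneg_left h6 (ha k)) h7 h8
              (mul_nonneg (ha k) hw)
    linarith

/-! ### Independence and fresh randomness -/

/-- Regrouping three σ-algebras: `m₂ ⊔ m₃` is generated by the intersections of an event of `m₂`
with an event of `m₃`, on which independence of `m₁` can be checked. -/
theorem ProbabilityTheory.Indep.sup_right {m₁ m₂ m₃ : MeasurableSpace Ω} (h₁ : m₁ ≤ m0)
    (h₂ : m₂ ≤ m0) (h₃ : m₃ ≤ m0) (h12 : Indep m₁ m₂ P) (h123 : Indep (m₁ ⊔ m₂) m₃ P) :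
    Indep m₁ (m₂ ⊔ m₃) P := by
  refine IndepSets.indep h₁ (sup_le h₂ h₃) (p1 := {s | MeasurableSet[m₁] s})
    (p2 := Set.image2 (· ∩ ·) {s | MeasurableSet[m₂] s} {t | MeasurableSet[m₃] t})
    (@MeasurableSpace.isPiSystem_measurableSet Ω m₁) ?_
    (@MeasurableSpace.generateFrom_measurableSet Ω m₁).symm ?_ ?_
  · rintro _ ⟨s, hs, t, ht, rfl⟩ _ ⟨s', hs', t', ht', rfl⟩ -
    exact ⟨s ∩ s', hs.inter hs', t ∩ t', ht.inter ht', Set.inter_inter_inter_comm _ _ _ _⟩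
  · refine le_antisymm (sup_le ?_ ?_) (MeasurableSpace.generateFrom_le ?_)
    · exact fun s hs => MeasurableSpace.measurableSet_generateFrom
        ⟨s, hs, Set.univ, MeasurableSet.univ, Set.inter_univ s⟩
    · exact fun t ht => MeasurableSpace.measurableSet_generateFrom
        ⟨Set.univ, MeasurableSet.univ, t, ht, Set.univ_inter t⟩
    · rintro _ ⟨s, hs, t, ht, rfl⟩
      exact MeasurableSet.inter ((le_sup_left : m₂ ≤ m₂ ⊔ m₃) s hs)
        ((le_sup_right : m₃ ≤ m₂ ⊔ m₃) t ht)
  · rw [IndepSets_iff]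
    rintro s _ hs ⟨t, ht, u, hu, rfl⟩
    rw [Indep_iff] at h12 h123
    have h4 := h123 (s ∩ t) u (MeasurableSet.inter ((le_sup_left : m₁ ≤ m₁ ⊔ m₂) s hs)
      ((le_sup_right : m₂ ≤ m₁ ⊔ m₂) t ht)) hu
    have h5 := h123 t u ((le_sup_right : m₂ ≤ m₁ ⊔ m₂) t ht) hu
    rw [← Set.inter_assoc, h4, h5, h12 s t hs ht, mul_assoc]

section Fresh
variable {S T : Type*} [MeasurableSpace S] [MeasurableSpace T] {X : Ω → S} {Y : Ω → T}

/-- Freezing: with `X` and `Y` independent, `Y` can be integrated first, with `X` held fixed. -/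
theorem lintegral_comp_of_indepFun (hX : Measurable X) (hY : Measurable Y)
    (h : IndepFun X Y P) {φ : S → T → ENNReal} (hφ : Measurable (Function.uncurry φ)) :
    ∫⁻ ω, φ (X ω) (Y ω) ∂P = ∫⁻ ω, ∫⁻ t, φ (X ω) t ∂(P.map Y) ∂P := by
  have h1 := (indepFun_iff_map_prod_eq_prod_map_map hX.aemeasurable hY.aemeasurable).1 h
  have : IsProbabilityMeasure (P.map Y) := Measure.isProbabilityMeasure_map hY.aemeasurable
  calc ∫⁻ ω, φ (X ω) (Y ω) ∂P
      = ∫⁻ z, Function.uncurry φ z ∂(P.map fun ω => (X ω, Y ω)) :=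
        (lintegral_map hφ (hX.prodMk hY)).symm
    _ = ∫⁻ x, ∫⁻ t, φ x t ∂(P.map Y) ∂(P.map X) := by
        rw [h1, lintegral_prod _ hφ.aemeasurable]; rfl
    _ = _ := lintegral_map hφ.lintegral_prod_right' hX

/-- Real-valued version of `lintegral_comp_of_indepFun`. -/
theorem integral_comp_of_indepFun (hX : Measurable X) (hY : Measurable Y)
    (h : IndepFun X Y P) {φ : S → T → ℝ} (hφ : Measurable (Function.uncurry φ))
    (hint : Integrable (fun ω => φ (X ω) (Y ω)) P) :
    ∫ ω, φ (X ω) (Y ω) ∂P = ∫ ω, ∫ t, φ (X ω) t ∂(P.map Y) ∂P := by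
  have h1 := (indepFun_iff_map_prod_eq_prod_map_map hX.aemeasurable hY.aemeasurable).1 h
  have : IsProbabilityMeasure (P.map Y) := Measure.isProbabilityMeasure_map hY.aemeasurable
  have : IsProbabilityMeasure (P.map X) := Measure.isProbabilityMeasure_map hX.aemeasurable
  have hXY : Measurable fun ω => (X ω, Y ω) := hX.prodMk hY
  have h2 : Integrable (Function.uncurry φ) ((P.map X).prod (P.map Y)) := by
    rw [← h1]
    exact (integrable_map_measure hφ.aestronglyMeasurable hXY.aemeasurable).2 hint
  calc ∫ ω, φ (X ω) (Y ω) ∂P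
      = ∫ z, Function.uncurry φ z ∂(P.map fun ω => (X ω, Y ω)) :=
        (integral_map hXY.aemeasurable hφ.aestronglyMeasurable).symm
    _ = ∫ x, ∫ t, φ x t ∂(P.map Y) ∂(P.map X) := by
        rw [h1, integral_prod _ h2]; rfl
    _ = _ := integral_map hX.aemeasurable
        hφ.stronglyMeasurable.integral_prod_right'.aestronglyMeasurable

end Fresh
end Probability

/-! ### Moments of Laplace noise -/

theorem integral_id_laplaceMeasure (b : ℝ) : ∫ t, t ∂(laplaceMeasure b) = 0 := by
  rw [laplaceMeasure, integral_withDensity_eq_integral_toReal_smul (by fun_prop) (by simp)]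
  set f : ℝ → ℝ := fun t => (ENNReal.ofReal ((2 * b)⁻¹ * Real.exp (-|t| / b))).toReal • t with hf
  have h1 : ∫ t, f (-t) = ∫ t, f t := integral_neg_eq_self f volume
  have h2 : ∀ t, f (-t) = -f t := fun t => by simp [hf]
  simp only [h2, integral_neg] at h1
  linarith

theorem lintegral_sq_laplaceMeasure {b : ℝ} (hb : 0 < b) :
    ∫⁻ t, ENNReal.ofReal (t ^ 2) ∂(laplaceMeasure b) = ENNReal.ofReal (2 * b ^ 2) := by
  rw [laplaceMeasure, lintegral_withDensity_eq_lintegral_mul _ (by fun_prop) (by fun_prop)]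
  set f : ℝ → ℝ := fun t => (2 * b)⁻¹ * Real.exp (-t / b) * t ^ 2 with hf
  have h1 : ∫ t in Set.Ioi (0 : ℝ), f t = b ^ 2 := by
    have h2 := Real.integral_rpow_mul_exp_neg_mul_Ioi (a := 3) (r := b⁻¹) (by norm_num)
      (inv_pos.2 hb)
    have h3 : ∀ t : ℝ, f t = (2 * b)⁻¹ * (t ^ ((3 : ℝ) - 1) * Real.exp (-(b⁻¹ * t))) := by
      intro t
      have h4 : (3 : ℝ) - 1 = ((2 : ℕ) : ℝ) := by norm_num
      rw [h4, Real.rpow_natCast]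
      simp only [hf]
      rw [show -t / b = -(b⁻¹ * t) by ring]
      ring
    have h5 : Real.Gamma 3 = 2 := by
      rw [show (3 : ℝ) = ((2 : ℕ) : ℝ) + 1 by norm_num, Real.Gamma_nat_eq_factorial]
      norm_num
    have h6 : (1 / b⁻¹) ^ (3 : ℝ) = b ^ 3 := by
      rw [one_div, inv_inv]
      exact_mod_cast Real.rpow_natCast b 3
    simp only [h3]
    rw [integral_const_mul, h2, h5, h6]
    field_simp
  have h2 : ∫ t, f |t| = 2 * b ^ 2 := by rw [integral_comp_abs, h1]
  have h3 : Integrable fun t => f |t| := Integrable.of_integral_ne_zero (by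
    rw [h2]; positivity)
  rw [← h2, ofReal_integral_eq_lintegral_ofReal h3 (ae_of_all _ fun t => by
    simp only [hf]; positivity)]
  refine lintegral_congr fun t => ?_
  simp only [hf, Pi.mul_apply]
  rw [← ENNReal.ofReal_mul (by positivity), sq_abs]

section Vector
variable {d : ℕ} {Ω : Type*} {m0 : MeasurableSpace Ω} {P : Measure Ω}

theorem lintegral_enorm_sq_of_laplace {v : Ω → EuclideanSpace ℝ (Fin d)} (hv : Measurable v) {b : ℝ}
    (hb : 0 < b) (hlaw : ∀ r, P.map (fun ω => v ω r) = laplaceMeasure b) :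
    ∫⁻ x, ‖x‖ₑ ^ 2 ∂(P.map v) ≤ ENNReal.ofReal (d * (2 * b ^ 2)) := by
  have h1 : ∀ x : EuclideanSpace ℝ (Fin d), ‖x‖ₑ ^ 2 = ∑ r, ENNReal.ofReal (x r ^ 2) := by
    intro x
    rw [← ofReal_norm, ← ENNReal.ofReal_pow (norm_nonneg _), EuclideanSpace.norm_sq_eq,
      ENNReal.ofReal_sum_of_nonneg fun _ _ => sq_nonneg _]
    simp
  have h2 : ∀ r, ∫⁻ x, ENNReal.ofReal (x r ^ 2) ∂(P.map v) = ENNReal.ofReal (2 * b ^ 2) := by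
    intro r
    have hm : Measurable fun ω => v ω r := by fun_prop
    rw [lintegral_map (by fun_prop) hv, ← lintegral_sq_laplaceMeasure hb, ← hlaw r,
      lintegral_map (by fun_prop) hm]
  simp only [h1]
  rw [lintegral_finsetSum _ fun r _ => by fun_prop]
  simp only [h2]
  rw [Finset.sum_const, Finset.card_univ, Fintype.card_fin, ← ENNReal.ofReal_nsmul, nsmul_eq_mul]

theorem integral_of_laplace {v : Ω → EuclideanSpace ℝ (Fin d)} (hv : Measurable v) {b : ℝ}
    (hlaw : ∀ r, P.map (fun ω => v ω r) = laplaceMeasure b)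
    (hint : Integrable (fun x => x) (P.map v)) :
    ∫ x, x ∂(P.map v) = 0 := by
  ext r
  have h1 := (EuclideanSpace.proj r : EuclideanSpace ℝ (Fin d) →L[ℝ] ℝ).integral_comp_comm hint
  simp only [PiLp.proj_apply] at h1
  rw [← h1, integral_map hv.aemeasurable (by fun_prop)]
  have hm : Measurable fun ω => v ω r := by fun_prop
  have h2 := integral_map (μ := P) hm.aemeasurable (f := fun t : ℝ => t) (by fun_prop)
  rw [hlaw, integral_id_laplaceMeasure] at h2
  simpa using h2.symm
end Vector

/-! ### Fresh estimates -/

theorem memLp_two_of_lintegral_enorm_sq_lt_top {E S : Type*} [NormedAddCommGroup E]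
    [MeasurableSpace S] {μ : Measure S} {f : S → E} (hf : AEStronglyMeasurable f μ)
    (h : ∫⁻ ω, ‖f ω‖ₑ ^ 2 ∂μ < ⊤) : MemLp f 2 μ := by
  rw [memLp_two_iff_integrable_sq_norm hf]
  refine ⟨(hf.norm.pow 2), ?_⟩
  rw [hasFiniteIntegral_iff_enorm]
  simpa [enorm_pow] using h

theorem integrable_inner_of_memLp_two {E S : Type*} [NormedAddCommGroup E] [InnerProductSpace ℝ E]
    [MeasurableSpace S]
    {μ : Measure S} {f g : S → E} (hf : MemLp f 2 μ) (hg : MemLp g 2 μ) :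
    Integrable (fun ω => inner ℝ (f ω) (g ω)) μ :=
  (hf.norm.integrable_mul hg.norm).mono' (hf.1.inner hg.1)
    (ae_of_all _ fun _ => norm_inner_le_norm _ _)

section Fresh
variable {Ω : Type*} {F m0 : MeasurableSpace Ω} {P : Measure Ω} [IsProbabilityMeasure P]
  {E T : Type*} [NormedAddCommGroup E] [MeasurableSpace E] [BorelSpace E]
  [SecondCountableTopology E] [MeasurableSpace T]
  {X : Ω → E} {Y : Ω → T} {e : E → T → E}

omit [SecondCountableTopology E] in
/-- Second moment of a fresh estimate `e (X ω) (Y ω)` over a past event: `X` is known from the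
past `F` and `Y` is independent of it. -/
theorem setLIntegral_enorm_sq_le_of_indep (hF : F ≤ m0) (hX : Measurable[F] X) (hY : Measurable Y)
    (h : Indep F (MeasurableSpace.comap Y inferInstance) P)
    (he : Measurable (Function.uncurry e)) {v : ENNReal}
    (hv : ∀ x, ∫⁻ t, ‖e x t‖ₑ ^ 2 ∂(P.map Y) ≤ v) {s : Set Ω} (hs : MeasurableSet[F] s) :
    ∫⁻ ω in s, ‖e (X ω) (Y ω)‖ₑ ^ 2 ∂P ≤ v * P s := by
  -- the event is frozen together with `X`
  have hX' : Measurable[F] fun ω => (s.indicator (fun _ => (1 : ENNReal)) ω, X ω) :=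
    Measurable.prodMk (measurable_const.indicator hs) hX
  have hind : IndepFun (fun ω => (s.indicator (fun _ => (1 : ENNReal)) ω, X ω)) Y P :=
    indep_of_indep_of_le_left h hX'.comap_le
  have key := lintegral_comp_of_indepFun (hX'.mono hF le_rfl) hY hind
    (φ := fun p t => p.1 * ‖e p.2 t‖ₑ ^ 2) (by
      have h1 : Measurable fun q : (ENNReal × E) × T => Function.uncurry e (q.1.2, q.2) :=
        he.comp (by fun_prop)
      exact (measurable_fst.comp measurable_fst).mul (h1.enorm.pow_const 2))
  have hs' := hF s hs
  calc ∫⁻ ω in s, ‖e (X ω) (Y ω)‖ₑ ^ 2 ∂P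
      = ∫⁻ ω, s.indicator (fun _ => (1 : ENNReal)) ω * ‖e (X ω) (Y ω)‖ₑ ^ 2 ∂P := by
        rw [← lintegral_indicator hs']
        refine lintegral_congr fun ω => ?_
        by_cases hω : ω ∈ s <;> simp [hω]
    _ = _ := key
    _ ≤ ∫⁻ ω, s.indicator (fun _ => v) ω ∂P := by
        refine lintegral_mono fun ω => ?_
        by_cases hω : ω ∈ s <;> simp [hω, hv]
    _ = v * P s := by rw [lintegral_indicator hs', setLIntegral_const]

theorem memLp_two_of_indep (hF : F ≤ m0) (hX : Measurable[F] X) (hY : Measurable Y)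
    (h : Indep F (MeasurableSpace.comap Y inferInstance) P)
    (he : Measurable (Function.uncurry e)) {v : ℝ}
    (hv : ∀ x, ∫⁻ t, ‖e x t‖ₑ ^ 2 ∂(P.map Y) ≤ ENNReal.ofReal v) :
    MemLp (fun ω => e (X ω) (Y ω)) 2 P := by
  have hm : Measurable fun ω => e (X ω) (Y ω) := he.comp ((hX.mono hF le_rfl).prodMk hY)
  refine memLp_two_of_lintegral_enorm_sq_lt_top hm.aestronglyMeasurable ?_
  have := setLIntegral_enorm_sq_le_of_indep hF hX hY h he hv (s := Set.univ)
    (@MeasurableSet.univ _ F)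
  rw [Measure.restrict_univ, measure_univ, mul_one] at this
  exact this.trans_lt ENNReal.ofReal_lt_top

omit [SecondCountableTopology E] in
theorem setIntegral_norm_sq_le_of_indep (hF : F ≤ m0) (hX : Measurable[F] X) (hY : Measurable Y)
    (h : Indep F (MeasurableSpace.comap Y inferInstance) P)
    (he : Measurable (Function.uncurry e)) {v : ℝ} (hv0 : 0 ≤ v)
    (hv : ∀ x, ∫⁻ t, ‖e x t‖ₑ ^ 2 ∂(P.map Y) ≤ ENNReal.ofReal v) {s : Set Ω}
    (hs : MeasurableSet[F] s) :
    ∫ ω in s, ‖e (X ω) (Y ω)‖ ^ 2 ∂P ≤ v * P.real s := by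
  have hm : Measurable fun ω => e (X ω) (Y ω) := he.comp ((hX.mono hF le_rfl).prodMk hY)
  rw [integral_eq_lintegral_of_nonneg_ae (ae_of_all _ fun ω => sq_nonneg _)
    (hm.norm.pow_const 2).aestronglyMeasurable]
  have h1 := setLIntegral_enorm_sq_le_of_indep hF hX hY h he hv hs
  have h2 : ∀ ω, ENNReal.ofReal (‖e (X ω) (Y ω)‖ ^ 2) = ‖e (X ω) (Y ω)‖ₑ ^ 2 := fun ω => by
    rw [ENNReal.ofReal_pow (norm_nonneg _), ofReal_norm]
  simp only [h2]
  refine (ENNReal.toReal_mono (ENNReal.mul_ne_top ENNReal.ofReal_ne_top (measure_ne_top _ _))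
    h1).trans_eq ?_
  rw [ENNReal.toReal_mul, ENNReal.toReal_ofReal hv0, measureReal_def]

/-- A fresh unbiased estimate is orthogonal to everything known from the past. -/
theorem setIntegral_inner_eq_zero_of_indep [InnerProductSpace ℝ E] [CompleteSpace E]
    (hF : F ≤ m0) (hX : Measurable[F] X)
    (hY : Measurable Y) (h : Indep F (MeasurableSpace.comap Y inferInstance) P)
    (he : Measurable (Function.uncurry e)) {v : ℝ}
    (hv : ∀ x, ∫⁻ t, ‖e x t‖ₑ ^ 2 ∂(P.map Y) ≤ ENNReal.ofReal v)
    (hmean : ∀ x, ∫ t, e x t ∂(P.map Y) = 0) {u : Ω → E} (hu : Measurable[F] u)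
    (hu2 : MemLp u 2 P) {s : Set Ω} (hs : MeasurableSet[F] s) :
    ∫ ω in s, inner ℝ (u ω) (e (X ω) (Y ω)) ∂P = 0 := by
  have hs' := hF s hs
  have hX' : Measurable[F] fun ω => (s.indicator u ω, X ω) :=
    Measurable.prodMk (hu.indicator hs) hX
  have hind : IndepFun (fun ω => (s.indicator u ω, X ω)) Y P :=
    indep_of_indep_of_le_left h hX'.comap_le
  have hL2 := memLp_two_of_indep hF hX hY h he hv
  have : IsProbabilityMeasure (P.map Y) := Measure.isProbabilityMeasure_map hY.aemeasurable
  have key := integral_comp_of_indepFun (hX'.mono hF le_rfl) hY hind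
    (φ := fun p t => inner ℝ p.1 (e p.2 t)) (by
      have h1 : Measurable fun q : (E × E) × T => Function.uncurry e (q.1.2, q.2) :=
        he.comp (by fun_prop)
      exact (measurable_fst.comp measurable_fst).inner h1)
    (integrable_inner_of_memLp_two (hu2.indicator hs') hL2)
  calc ∫ ω in s, inner ℝ (u ω) (e (X ω) (Y ω)) ∂P
      = ∫ ω, inner ℝ (s.indicator u ω) (e (X ω) (Y ω)) ∂P := by
        rw [← integral_indicator hs']
        refine integral_congr_ae (ae_of_all _ fun ω => ?_)
        by_cases hω : ω ∈ s <;> simp [hω]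
    _ = _ := key
    _ = 0 := by
        refine integral_eq_zero_of_ae (ae_of_all _ fun ω => ?_)
        have h2 : MemLp (e (X ω)) 2 (P.map Y) :=
          memLp_two_of_lintegral_enorm_sq_lt_top
            (he.comp measurable_prodMk_left).aestronglyMeasurable
            ((hv _).trans_lt ENNReal.ofReal_lt_top)
        have h3 := integral_inner (𝕜 := ℝ) (h2.integrable one_le_two) (s.indicator u ω)
        simp only [h3, hmean, inner_zero_right, Pi.zero_apply]
end Fresh

/-! ### The history of the algorithm -/

section History
variable {n d : ℕ} {Ω : Type*} {m0 : MeasurableSpace Ω} {P : Measure Ω} [IsProbabilityMeasure P]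
  {Ξ : Fin n → Type*} [∀ i, MeasurableSpace (Ξ i)] {γ : ℕ → ℕ}

/-- The σ-algebra generated by the privacy noises of the times before `k`. -/
abbrev noisePast (noise : Fin n → ℕ → Ω → EuclideanSpace ℝ (Fin d)) (k : ℕ) : MeasurableSpace Ω :=
  ⨆ p ∈ {p : Fin n × ℕ | p.2 < k}, MeasurableSpace.comap (noise p.1 p.2) inferInstance

/-- The σ-algebra generated by the data samples of the times before `k`. -/
abbrev samplePast (ξ : ∀ (i : Fin n) (k : ℕ), Fin (γ k) → Ω → Ξ i) (k : ℕ) : MeasurableSpace Ω :=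
  ⨆ j ∈ {j : ℕ | j < k},
    MeasurableSpace.comap (fun ω => fun (i : Fin n) (l : Fin (γ j)) => ξ i j l ω) inferInstance

variable {noise : Fin n → ℕ → Ω → EuclideanSpace ℝ (Fin d)}
  {ξ : ∀ (i : Fin n) (k : ℕ), Fin (γ k) → Ω → Ξ i}

theorem noisePast_mono : Monotone (noisePast noise) := fun _ _ h =>
  biSup_mono fun _ hp => lt_of_lt_of_le hp h

theorem samplePast_mono : Monotone (samplePast ξ) := fun _ _ h =>
  biSup_mono fun _ hp => lt_of_lt_of_le hp h

theorem noisePast_le (hm : ∀ i k, Measurable (noise i k)) (k : ℕ) : noisePast noise k ≤ m0 :=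
  iSup₂_le fun p _ => (hm p.1 p.2).comap_le

theorem measurable_samples (hm : ∀ i k l, Measurable (ξ i k l)) (k : ℕ) :
    Measurable fun ω => fun (i : Fin n) (l : Fin (γ k)) => ξ i k l ω :=
  measurable_pi_lambda _ fun i => measurable_pi_lambda _ fun l => hm i k l

theorem samplePast_le (hm : ∀ i k l, Measurable (ξ i k l)) (k : ℕ) : samplePast ξ k ≤ m0 :=
  iSup₂_le fun j _ => (measurable_samples hm j).comap_le

/-- The history of the algorithm: the `k`-th σ-algebra is generated by all noises and samples of
the times before `k`. -/
def history (hn : ∀ i k, Measurable (noise i k)) (hs : ∀ i k l, Measurable (ξ i k l)) :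
    Filtration ℕ m0 where
  seq k := noisePast noise k ⊔ samplePast ξ k
  mono' _ _ h := sup_le_sup (noisePast_mono h) (samplePast_mono h)
  le' k := sup_le (noisePast_le hn k) (samplePast_le hs k)

theorem measurable_noise_history (hn : ∀ i k, Measurable (noise i k))
    (hs : ∀ i k l, Measurable (ξ i k l)) (i : Fin n) (k : ℕ) :
    Measurable[history hn hs (k + 1)] (noise i k) := by
  rw [measurable_iff_comap_le]
  refine le_trans ?_ (le_sup_left : noisePast noise (k + 1) ≤ _)
  exact le_iSup₂_of_le (f := fun (p : Fin n × ℕ) (_ : p ∈ {p : Fin n × ℕ | p.2 < k + 1}) =>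
    MeasurableSpace.comap (noise p.1 p.2) inferInstance) (i, k) (Nat.lt_succ_self k) le_rfl

theorem measurable_sample_history (hn : ∀ i k, Measurable (noise i k))
    (hs : ∀ i k l, Measurable (ξ i k l)) (i : Fin n) (k : ℕ) (l : Fin (γ k)) :
    Measurable[history hn hs (k + 1)] (ξ i k l) := by
  have h1 : Measurable[history hn hs (k + 1)]
      (fun ω => fun (i : Fin n) (l : Fin (γ k)) => ξ i k l ω) := by
    rw [measurable_iff_comap_le]
    refine le_trans ?_ (le_sup_right : samplePast ξ (k + 1) ≤ _)
    exact le_iSup₂_of_le (f := fun (j : ℕ) (_ : j ∈ {j : ℕ | j < k + 1}) =>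
      MeasurableSpace.comap (fun ω => fun (i : Fin n) (l : Fin (γ j)) => ξ i j l ω) inferInstance)
      k (Nat.lt_succ_self k) le_rfl
  exact ((measurable_pi_apply l).comp (measurable_pi_apply i)).comp h1

theorem noise_comap_le (i : Fin n) (k : ℕ) :
    MeasurableSpace.comap (noise i k) inferInstance ≤
      MeasurableSpace.comap (fun ω => fun (i : Fin n) (k : ℕ) => noise i k ω) inferInstance := by
  have h1 : noise i k = (fun f : Fin n → ℕ → EuclideanSpace ℝ (Fin d) => f i k) ∘
    (fun ω => fun (i : Fin n) (k : ℕ) => noise i k ω) := rfl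
  rw [h1, ← MeasurableSpace.comap_comp]
  exact MeasurableSpace.comap_mono (Measurable.comap_le (by fun_prop))

theorem samples_comap_le (k : ℕ) :
    MeasurableSpace.comap (fun ω => fun (i : Fin n) (l : Fin (γ k)) => ξ i k l ω) inferInstance ≤
      MeasurableSpace.comap
        (fun ω => fun (i : Fin n) (k : ℕ) (l : Fin (γ k)) => ξ i k l ω) inferInstance := by
  have h1 : (fun ω => fun (i : Fin n) (l : Fin (γ k)) => ξ i k l ω) =
    (fun (f : ∀ (i : Fin n) (k : ℕ), Fin (γ k) → Ξ i) i l => f i k l) ∘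
    (fun ω => fun (i : Fin n) (k : ℕ) (l : Fin (γ k)) => ξ i k l ω) := rfl
  rw [h1, ← MeasurableSpace.comap_comp]
  refine MeasurableSpace.comap_mono (Measurable.comap_le ?_)
  fun_prop

variable (hind : IndepFun (fun ω => fun (i : Fin n) (k : ℕ) => noise i k ω)
      (fun ω => fun (i : Fin n) (k : ℕ) (l : Fin (γ k)) => ξ i k l ω) P)
include hind

/-- The noise of round `k` is independent of the earlier noises and samples. -/
theorem indep_history_noise (hn : ∀ i k, Measurable (noise i k))
    (hs : ∀ i k l, Measurable (ξ i k l))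
    (hnoise : iIndepFun (fun p : Fin n × ℕ => noise p.1 p.2) P) (i : Fin n) (k : ℕ) :
    Indep (history hn hs k) (MeasurableSpace.comap (noise i k) inferInstance) P := by
  have h1 := indep_iSup_of_disjoint (m := fun p : Fin n × ℕ =>
      MeasurableSpace.comap (noise p.1 p.2) inferInstance) (fun p => (hn p.1 p.2).comap_le)
    hnoise.iIndep (S := {(i, k)}) (T := {p | p.2 < k})
    (Set.disjoint_singleton_left.2 (by simp))
  rw [iSup_singleton] at h1
  refine (Indep.sup_right (hn i k).comap_le (noisePast_le hn k) (samplePast_le hs k) h1 ?_).symm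
  refine indep_of_indep_of_le_left (indep_of_indep_of_le_right hind ?_) ?_
  · exact iSup₂_le fun j _ => samples_comap_le j
  · exact sup_le (noise_comap_le i k) (iSup₂_le fun p _ => noise_comap_le p.1 p.2)

/-- Each sample of round `k` is independent of the earlier noises and samples. -/
theorem indep_history_sample (hn : ∀ i k, Measurable (noise i k))
    (hs : ∀ i k l, Measurable (ξ i k l))
    (hξ : iIndepFun (fun k ω => fun (i : Fin n) (l : Fin (γ k)) => ξ i k l ω) P)
    (i : Fin n) (k : ℕ) (l : Fin (γ k)) :
    Indep (history hn hs k) (MeasurableSpace.comap (ξ i k l) inferInstance) P := by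
  have h1 := indep_iSup_of_disjoint (m := fun k : ℕ =>
      MeasurableSpace.comap (fun ω => fun (i : Fin n) (l : Fin (γ k)) => ξ i k l ω) inferInstance)
    (fun k => (measurable_samples hs k).comap_le)
    hξ.iIndep (S := {k}) (T := {j | j < k}) (Set.disjoint_singleton_left.2 (by simp))
  rw [iSup_singleton] at h1
  have h2 := Indep.sup_right (measurable_samples hs k).comap_le (samplePast_le hs k)
    (noisePast_le hn k) h1 ?_
  · rw [sup_comm] at h2
    refine indep_of_indep_of_le_right h2.symm ?_
    have h3 : ξ i k l = (fun f : ∀ i : Fin n, Fin (γ k) → Ξ i => f i l) ∘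
      (fun ω => fun (i : Fin n) (l : Fin (γ k)) => ξ i k l ω) := rfl
    rw [h3, ← MeasurableSpace.comap_comp]
    exact MeasurableSpace.comap_mono (Measurable.comap_le (by fun_prop))
  · refine indep_of_indep_of_le_left (indep_of_indep_of_le_right hind.symm ?_) ?_
    · exact iSup₂_le fun p _ => noise_comap_le p.1 p.2
    · exact sup_le (samples_comap_le k) (iSup₂_le fun j _ => samples_comap_le j)

end History

/-! ### The noise of one round -/

section Measurability
variable {n d : ℕ} {S : Type*} {mS : MeasurableSpace S}

theorem Measurable.agentMean {z : Fin n → S → EuclideanSpace ℝ (Fin d)}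
    (hz : ∀ i, Measurable (z i)) : Measurable fun ω => agentMean fun i => z i ω := by
  unfold _root_.agentMean
  fun_prop

theorem Measurable.lyapunov {z : Fin n → S → EuclideanSpace ℝ (Fin d)} (c : ℝ)
    (hz : ∀ i, Measurable (z i)) : Measurable fun ω => lyapunov c fun i => z i ω := by
  have := Measurable.agentMean hz
  unfold _root_.lyapunov
  fun_prop

theorem Measurable.lyapunovGrad {z : Fin n → S → EuclideanSpace ℝ (Fin d)} (c : ℝ)
    (hz : ∀ i, Measurable (z i)) (i : Fin n) :
    Measurable fun ω => lyapunovGrad c (fun i => z i ω) i := by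
  have := Measurable.agentMean hz
  unfold _root_.lyapunovGrad
  fun_prop

theorem MeasureTheory.MemLp.agentMean {P : Measure S} {z : Fin n → S → EuclideanSpace ℝ (Fin d)}
    (hz : ∀ i, MemLp (z i) 2 P) : MemLp (fun ω => agentMean fun i => z i ω) 2 P := by
  unfold _root_.agentMean
  exact (memLp_finsetSum _ fun i _ => hz i).const_smul (n : ℝ)⁻¹

theorem MeasureTheory.MemLp.lyapunovGrad {P : Measure S}
    {z : Fin n → S → EuclideanSpace ℝ (Fin d)} (c : ℝ)
    (hz : ∀ i, MemLp (z i) 2 P) (i : Fin n) :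
    MemLp (fun ω => lyapunovGrad c (fun i => z i ω) i) 2 P := by
  unfold _root_.lyapunovGrad
  exact ((MemLp.agentMean hz).const_smul (n : ℝ)⁻¹).add
    (((hz i).sub (MemLp.agentMean hz)).const_smul c)

theorem MeasureTheory.MemLp.integrable_norm_sq {P : Measure S}
    {z : S → EuclideanSpace ℝ (Fin d)} (hz : MemLp z 2 P) :
    Integrable (fun ω => ‖z ω‖ ^ 2) P :=
  (memLp_two_iff_integrable_sq_norm hz.1).1 hz

theorem integrable_lyapunov {P : Measure S} {z : Fin n → S → EuclideanSpace ℝ (Fin d)} (c : ℝ)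
    (hz : ∀ i, MemLp (z i) 2 P) : Integrable (fun ω => lyapunov c fun i => z i ω) P := by
  unfold lyapunov
  exact (MemLp.agentMean hz).integrable_norm_sq.add ((integrable_finsetSum _ fun i _ =>
    ((hz i).sub (MemLp.agentMean hz)).integrable_norm_sq).const_mul c)

theorem MeasureTheory.MemLp.comp_lipschitz {P : Measure S} [IsFiniteMeasure P]
    {z : S → EuclideanSpace ℝ (Fin d)}
    {f : EuclideanSpace ℝ (Fin d) → EuclideanSpace ℝ (Fin d)} {C : ℝ}
    (hf : ∀ x y, ‖f x - f y‖ ≤ C * ‖x - y‖) (hfm : Measurable f) (hz : MemLp z 2 P) :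
    MemLp (fun ω => f (z ω)) 2 P := by
  have h1 : MemLp (fun ω => ‖f 0‖ + C * ‖z ω‖) 2 P := by
    have h2 : MemLp (fun ω => C * ‖z ω‖) 2 P := hz.norm.const_mul C
    have h3 : MemLp (fun _ : S => ‖f 0‖) 2 P := memLp_const _
    exact h3.add h2
  refine h1.of_le (hfm.comp_aemeasurable hz.1.aemeasurable).aestronglyMeasurable
    (ae_of_all _ fun ω => ?_)
  have h2 := hf (z ω) 0
  rw [sub_zero] at h2
  have h3 := norm_le_norm_add_norm_sub' (f (z ω)) (f 0)
  exact (h3.trans (by linarith)).trans (le_abs_self _)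
end Measurability

section Noise
variable {n d : ℕ} {Ω : Type*} {F m0 : MeasurableSpace Ω} {P : Measure Ω}
  [IsProbabilityMeasure P]

omit [IsProbabilityMeasure P] in
/-- Adding noise `N` that is orthogonal to the past `F` raises the integral of the Lyapunov
function only by the second moment of the noise. -/
theorem setIntegral_lyapunov_add_le {c v : ℝ} (hc : 0 ≤ c)
    {Z N : Fin n → Ω → EuclideanSpace ℝ (Fin d)} (hZ : ∀ i, Measurable[F] (Z i))
    (hZ2 : ∀ i, MemLp (Z i) 2 P) (hN2 : ∀ i, MemLp (N i) 2 P) {s : Set Ω}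
    (hN0 : ∀ i (u : Ω → EuclideanSpace ℝ (Fin d)), Measurable[F] u → MemLp u 2 P →
      ∫ ω in s, inner ℝ (u ω) (N i ω) ∂P = 0)
    (hNv : ∀ i, ∫ ω in s, ‖N i ω‖ ^ 2 ∂P ≤ v * P.real s) :
    ∫ ω in s, lyapunov c (fun i => Z i ω + N i ω) ∂P
      ≤ ∫ ω in s, lyapunov c (fun i => Z i ω) ∂P + (1 + c) * (n * v) * P.real s := by
  have hcross : ∀ i, Integrable
      (fun ω => inner ℝ (lyapunovGrad c (fun i => Z i ω) i) (N i ω)) P := fun i =>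
    integrable_inner_of_memLp_two (MemLp.lyapunovGrad c hZ2 i) (hN2 i)
  have hNsq : ∫ ω in s, lyapunov c (fun i => N i ω) ∂P ≤ (1 + c) * (n * v) * P.real s := by
    calc ∫ ω in s, lyapunov c (fun i => N i ω) ∂P
        ≤ ∫ ω in s, (1 + c) * ∑ i, ‖N i ω‖ ^ 2 ∂P :=
          integral_mono (integrable_lyapunov c hN2).integrableOn
            ((integrable_finsetSum _ fun i _ =>
              (hN2 i).integrable_norm_sq).const_mul _).integrableOn
            fun ω => lyapunov_le hc _
      _ = (1 + c) * ∑ i, ∫ ω in s, ‖N i ω‖ ^ 2 ∂P := by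
          rw [integral_const_mul, integral_finsetSum _ fun i _ =>
            (hN2 i).integrable_norm_sq.integrableOn]
      _ ≤ (1 + c) * ∑ _i : Fin n, v * P.real s := by
          refine mul_le_mul_of_nonneg_left (Finset.sum_le_sum fun i _ => hNv i) (by linarith)
      _ = _ := by simp; ring
  have h0 : ∫ ω in s, 2 * ∑ i, inner ℝ (lyapunovGrad c (fun i => Z i ω) i) (N i ω) ∂P = 0 := by
    rw [integral_const_mul, integral_finsetSum _ fun i _ => (hcross i).integrableOn]
    rw [Finset.sum_eq_zero fun i _ => hN0 i _ (Measurable.lyapunovGrad c hZ i)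
      (MemLp.lyapunovGrad c hZ2 i), mul_zero]
  simp only [lyapunov_add]
  have i1 := (integrable_lyapunov c hZ2).integrableOn (s := s)
  have i2 := ((integrable_finsetSum Finset.univ fun i _ => hcross i).const_mul 2).integrableOn
    (s := s)
  have h1 := integral_add (i1.add i2) (integrable_lyapunov c hN2).integrableOn
  have h2 := integral_add i1 i2
  simp only [Pi.add_apply] at h1
  rw [h1, h2, h0, add_zero]
  linarith

theorem norm_sum_sq_le {E : Type*} [NormedAddCommGroup E] [InnerProductSpace ℝ E]
    (w : Fin n → E) : ‖∑ i, w i‖ ^ 2 ≤ n * ∑ i, ‖w i‖ ^ 2 := by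
  rw [sum_eq_smul_agentMean, norm_smul, mul_pow, Real.norm_natCast, sq (n : ℝ), mul_assoc]
  exact mul_le_mul_of_nonneg_left (norm_agentMean_sq_le w) (Nat.cast_nonneg n)

/-! The noise of a round is `b • ∑ j, a j • ν j - t • agentMean e`, with the weights `a` of the
agent, the privacy noises `ν` and the errors `e` of the `m` sampled gradients. -/

variable {m : ℕ} {a : Fin n → ℝ} {b t : ℝ} {ν : Fin n → Ω → EuclideanSpace ℝ (Fin d)}
  {e : Fin m → Ω → EuclideanSpace ℝ (Fin d)}

omit [IsProbabilityMeasure P] in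
theorem memLp_stepNoise (hν : ∀ j, MemLp (ν j) 2 P) (he : ∀ l, MemLp (e l) 2 P) :
    MemLp (fun ω => b • ∑ j, a j • ν j ω - t • agentMean fun l => e l ω) 2 P :=
  ((memLp_finsetSum _ fun j _ => (hν j).const_smul (a j)).const_smul b).sub
    ((MemLp.agentMean he).const_smul t)

omit [IsProbabilityMeasure P] in
theorem setIntegral_inner_stepNoise (hν : ∀ j, MemLp (ν j) 2 P) (he : ∀ l, MemLp (e l) 2 P)
    {s : Set Ω} {u : Ω → EuclideanSpace ℝ (Fin d)} (hu : MemLp u 2 P)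
    (hν0 : ∀ j, ∫ ω in s, inner ℝ (u ω) (ν j ω) ∂P = 0)
    (he0 : ∀ l, ∫ ω in s, inner ℝ (u ω) (e l ω) ∂P = 0) :
    ∫ ω in s, inner ℝ (u ω) (b • ∑ j, a j • ν j ω - t • agentMean fun l => e l ω) ∂P = 0 := by
  have i1 := fun j => (integrable_inner_of_memLp_two hu (hν j)).integrableOn (s := s)
  have i2 := fun l => (integrable_inner_of_memLp_two hu (he l)).integrableOn (s := s)
  simp only [inner_sub_right, inner_smul_right, inner_sum, agentMean]
  rw [integral_sub ((integrable_finsetSum _ fun j _ => (i1 j).const_mul _).const_mul _)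
      (((integrable_finsetSum _ fun l _ => i2 l).const_mul _).const_mul _),
    integral_const_mul, integral_const_mul, integral_const_mul,
    integral_finsetSum _ fun j _ => (i1 j).const_mul _, integral_finsetSum _ fun l _ => i2 l]
  simp [integral_const_mul, hν0, he0]

omit [IsProbabilityMeasure P] in
/-- Second moment of the noise of a round. The bound for the averaged gradient error is that of a
single sample, by convexity. -/
theorem setIntegral_norm_sq_stepNoise_le (hm : m ≠ 0) (ha : ∀ j, |a j| ≤ 1)
    (hν : ∀ j, MemLp (ν j) 2 P) (he : ∀ l, MemLp (e l) 2 P) {s : Set Ω} {p q : ℝ}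
    (hν0 : ∀ j, ∫ ω in s, ‖ν j ω‖ ^ 2 ∂P ≤ p) (he0 : ∀ l, ∫ ω in s, ‖e l ω‖ ^ 2 ∂P ≤ q) :
    ∫ ω in s, ‖b • ∑ j, a j • ν j ω - t • agentMean fun l => e l ω‖ ^ 2 ∂P
      ≤ 2 * b ^ 2 * (n * (n * p)) + 2 * t ^ 2 * q := by
  have i1 := fun j => (hν j).integrable_norm_sq.integrableOn (s := s)
  have i2 := fun l => (he l).integrable_norm_sq.integrableOn (s := s)
  have hm0 : (0 : ℝ) < m := by exact_mod_cast Nat.pos_of_ne_zero hm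
  have j1 := (integrable_finsetSum Finset.univ fun j _ => i1 j).const_mul (2 * b ^ 2 * n)
  have j2 := (integrable_finsetSum Finset.univ fun l _ => i2 l).const_mul (2 * t ^ 2 * (m : ℝ)⁻¹)
  calc ∫ ω in s, ‖b • ∑ j, a j • ν j ω - t • agentMean fun l => e l ω‖ ^ 2 ∂P
      ≤ ∫ ω in s, (2 * b ^ 2 * n * ∑ j, ‖ν j ω‖ ^ 2
          + 2 * t ^ 2 * (m : ℝ)⁻¹ * ∑ l, ‖e l ω‖ ^ 2) ∂P := by
        refine integral_mono (memLp_stepNoise hν he).integrable_norm_sq.integrableOn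
          (j1.add j2) fun ω => ?_
        have h1 := norm_add_sq_le_weighted one_pos (b • ∑ j, a j • ν j ω)
          ((-t) • agentMean fun l => e l ω)
        rw [neg_smul, ← sub_eq_add_neg, norm_neg, norm_smul, norm_smul, mul_pow, mul_pow,
          Real.norm_eq_abs, Real.norm_eq_abs, sq_abs, sq_abs] at h1
        have h2 : ‖∑ j, a j • ν j ω‖ ^ 2 ≤ n * ∑ j, ‖ν j ω‖ ^ 2 := by
          refine (norm_sum_sq_le _).trans (mul_le_mul_of_nonneg_left
            (Finset.sum_le_sum fun j _ => ?_) (Nat.cast_nonneg n))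
          refine pow_le_pow_left₀ (norm_nonneg _) ?_ 2
          rw [norm_smul]
          exact mul_le_of_le_one_left (norm_nonneg _) (ha j)
        have h3 : ‖agentMean fun l => e l ω‖ ^ 2 ≤ (m : ℝ)⁻¹ * ∑ l, ‖e l ω‖ ^ 2 := by
          rw [← div_eq_inv_mul, le_div_iff₀' hm0]
          exact norm_agentMean_sq_le _
        have h4 := mul_le_mul_of_nonneg_left h2 (sq_nonneg b)
        have h5 := mul_le_mul_of_nonneg_left h3 (sq_nonneg t)
        norm_num at h1
        linarith
    _ = 2 * b ^ 2 * n * ∑ j, ∫ ω in s, ‖ν j ω‖ ^ 2 ∂P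
          + 2 * t ^ 2 * (m : ℝ)⁻¹ * ∑ l, ∫ ω in s, ‖e l ω‖ ^ 2 ∂P := by
        rw [integral_add j1 j2, integral_const_mul, integral_const_mul,
          integral_finsetSum _ fun j _ => i1 j, integral_finsetSum _ fun l _ => i2 l]
    _ ≤ 2 * b ^ 2 * n * ∑ _j : Fin n, p + 2 * t ^ 2 * (m : ℝ)⁻¹ * ∑ _l : Fin m, q := by
        refine add_le_add (mul_le_mul_of_nonneg_left (Finset.sum_le_sum fun j _ => hν0 j) ?_)
          (mul_le_mul_of_nonneg_left (Finset.sum_le_sum fun j _ => he0 j) ?_) <;> positivity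
    _ = _ := by
        simp only [Finset.sum_const, Finset.card_univ, Fintype.card_fin, nsmul_eq_mul]
        field_simp

end Noise

/-! ### The iterates -/

section Gradients
variable {n d : ℕ} {f : Fin n → EuclideanSpace ℝ (Fin d) → ℝ} {L : Fin n → ℝ} {m : ℝ}

theorem SmoothStronglyConvex.lipschitz_sum (hf : SmoothStronglyConvex f L m) (i : Fin n)
    (x y : EuclideanSpace ℝ (Fin d)) :
    ‖gradient (f i) x - gradient (f i) y‖ ≤ (∑ j, L j) * ‖x - y‖ :=
  (hf.lipschitz i x y).trans (mul_le_mul_of_nonneg_right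
    (Finset.single_le_sum (fun j _ => (hf.L_pos j).le) (Finset.mem_univ i)) (norm_nonneg _))

theorem SmoothStronglyConvex.measurable_gradient (hf : SmoothStronglyConvex f L m) (i : Fin n) :
    Measurable (gradient (f i)) := by
  have h1 : LipschitzWith (L i).toNNReal (gradient (f i)) :=
    LipschitzWith.of_dist_le_mul fun x y => by
      rw [dist_eq_norm, dist_eq_norm, Real.coe_toNNReal _ (hf.L_pos i).le]
      exact hf.lipschitz i x y
  exact h1.continuous.measurable

theorem SmoothStronglyConvex.exists_sum_gradient_eq_zero (hf : SmoothStronglyConvex f L m)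
    (hn : n ≠ 0) : ∃ p, ∑ i, gradient (f i) p = 0 := by
  have hn0 : (0 : ℝ) < n := by exact_mod_cast Nat.pos_of_ne_zero hn
  refine exists_eq_zero_of_lipschitz_of_strongMono (C := ∑ i, L i) (mul_pos hn0 hf.m_pos)
    (fun x y => ?_) fun x y => ?_
  · rw [← Finset.sum_sub_distrib, Finset.sum_mul]
    exact norm_sum_le_of_le _ fun i _ => hf.lipschitz i x y
  · rw [← Finset.sum_sub_distrib, sum_inner]
    calc (n : ℝ) * m * ‖x - y‖ ^ 2 = ∑ _i : Fin n, m * ‖x - y‖ ^ 2 := by simp; ring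
      _ ≤ _ := Finset.sum_le_sum fun i _ => hf.strongly_convex i x y

theorem SmoothStronglyConvex.sum_le_sum (hf : SmoothStronglyConvex f L m)
    {p : EuclideanSpace ℝ (Fin d)} (hp : ∑ i, gradient (f i) p = 0)
    (y : EuclideanSpace ℝ (Fin d)) : ∑ i, f i p ≤ ∑ i, f i y :=
  sum_le_sum_of_sum_gradient_eq_zero hf.differentiable
    (fun i x y => (mul_nonneg hf.m_pos.le (sq_nonneg _)).trans (hf.strongly_convex i x y)) hp y

variable {Ξ : Fin n → Type*} [∀ i, MeasurableSpace (Ξ i)] {D : ∀ i, Measure (Ξ i)}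
  [∀ i, IsProbabilityMeasure (D i)]
  {g : ∀ i, EuclideanSpace ℝ (Fin d) → Ξ i → EuclideanSpace ℝ (Fin d)} {σg : ℝ}

omit [∀ i, IsProbabilityMeasure (D i)] in
theorem measurable_sampleError (hf : SmoothStronglyConvex f L m)
    (hg : UnbiasedBoundedVariance D f g σg) (i : Fin n) :
    Measurable (Function.uncurry fun x s => g i x s - gradient (f i) x) :=
  (hg.measurable i).sub ((hf.measurable_gradient i).comp measurable_fst)

theorem UnbiasedBoundedVariance.integral_sampleError (hg : UnbiasedBoundedVariance D f g σg)
    (i : Fin n) (x : EuclideanSpace ℝ (Fin d)) : ∫ s, g i x s - gradient (f i) x ∂(D i) = 0 := by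
  rw [integral_sub (hg.integrable i x) (integrable_const _), hg.unbiased]
  simp

omit [∀ i, IsProbabilityMeasure (D i)] in
theorem UnbiasedBoundedVariance.lintegral_sampleError_le (hg : UnbiasedBoundedVariance D f g σg)
    (i : Fin n) (x : EuclideanSpace ℝ (Fin d)) :
    ∫⁻ s, ‖g i x s - gradient (f i) x‖ₑ ^ 2 ∂(D i) ≤ ENNReal.ofReal (σg ^ 2) := by
  refine le_trans (le_of_eq ?_) (ENNReal.ofReal_le_ofReal (hg.variance_le i x))
  rw [ofReal_integral_eq_lintegral_ofReal (hg.integrable_sq i x)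
    (ae_of_all _ fun _ => sq_nonneg _)]
  refine lintegral_congr fun s => ?_
  rw [ENNReal.ofReal_pow (norm_nonneg _), ofReal_norm]
end Gradients

section Iterates
variable {n d : ℕ} {Ω : Type*} {m0 : MeasurableSpace Ω} {P : Measure Ω} [IsProbabilityMeasure P]
  {Ξ : Fin n → Type*} [∀ i, MeasurableSpace (Ξ i)]
  {D : ∀ i, Measure (Ξ i)} [∀ i, IsProbabilityMeasure (D i)]
  {f : Fin n → EuclideanSpace ℝ (Fin d) → ℝ} {L : Fin n → ℝ} {m : ℝ}
  {g : ∀ i, EuclideanSpace ℝ (Fin d) → Ξ i → EuclideanSpace ℝ (Fin d)} {σg : ℝ}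
  {A : Matrix (Fin n) (Fin n) ℝ} {α β σ : ℕ → ℝ} {γ : ℕ → ℕ}
  {noise : Fin n → ℕ → Ω → EuclideanSpace ℝ (Fin d)}
  {ξ : ∀ (i : Fin n) (k : ℕ), Fin (γ k) → Ω → Ξ i} {x₀ : Fin n → EuclideanSpace ℝ (Fin d)}

theorem measurable_outputPerturbation (hn : ∀ i k, Measurable (noise i k))
    (hs : ∀ i k l, Measurable (ξ i k l))
    (hg : ∀ i, Measurable fun p : EuclideanSpace ℝ (Fin d) × Ξ i => g i p.1 p.2)
    (k : ℕ) (i : Fin n) :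
    Measurable[history hn hs k] (outputPerturbation A α β γ g x₀ noise ξ k i) := by
  induction k generalizing i with
  | zero => exact @measurable_const _ _ _ (history hn hs 0) _
  | succ k ih =>
    have hx : ∀ j, Measurable[history hn hs (k + 1)]
        (outputPerturbation A α β γ g x₀ noise ξ k j) := fun j =>
      (ih j).mono ((history hn hs).mono (Nat.le_succ k)) le_rfl
    have hν := fun j => measurable_noise_history hn hs j k
    have hgl : ∀ l, Measurable[history hn hs (k + 1)]
        fun ω => g i (outputPerturbation A α β γ g x₀ noise ξ k i ω) (ξ i k l ω) := fun l =>
      (hg i).comp ((hx i).prodMk (measurable_sample_history hn hs i k l))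
    have h1 : Measurable[history hn hs (k + 1)] fun ω =>
        ∑ j, A i j • (outputPerturbation A α β γ g x₀ noise ξ k j ω + noise j k ω) :=
      Finset.measurable_fun_sum _ fun j _ => ((hx j).add (hν j)).const_smul (A i j)
    have h2 : Measurable[history hn hs (k + 1)] fun ω =>
        ∑ l, g i (outputPerturbation A α β γ g x₀ noise ξ k i ω) (ξ i k l ω) :=
      Finset.measurable_fun_sum _ fun l _ => hgl l
    exact (((hx i).const_smul (1 - β k)).add (h1.const_smul (β k))).sub
      ((h2.const_smul (γ k : ℝ)⁻¹).const_smul (α k))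

omit [∀ i, MeasurableSpace (Ξ i)] in
/-- The update splits into the noiseless step and the noise of the round. -/
theorem outputPerturbation_succ_sub {k : ℕ} (hγ : γ k ≠ 0) (T : Fin n → EuclideanSpace ℝ (Fin d) →
      EuclideanSpace ℝ (Fin d)) (p : EuclideanSpace ℝ (Fin d)) (i : Fin n) (ω : Ω)
    {x : Fin n → EuclideanSpace ℝ (Fin d)}
    (hx : ∀ j, outputPerturbation A α β γ g x₀ noise ξ k j ω = x j) :
    outputPerturbation A α β γ g x₀ noise ξ (k + 1) i ω - p
      = ((1 - β k) • x i + β k • ∑ j, A i j • x j - α k • T i (x i) - p)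
        + (β k • ∑ j, A i j • noise j k ω
            - α k • agentMean fun l => g i (x i) (ξ i k l ω) - T i (x i)) := by
  rw [agentMean_sub, agentMean_const hγ]
  simp only [outputPerturbation, hx, smul_add, Finset.sum_add_distrib, agentMean]
  module

variable (hf : SmoothStronglyConvex f L m) (hg : UnbiasedBoundedVariance D f g σg)
  (hσ : ∀ k, 0 < σ k) (hγ : ∀ k, 1 ≤ γ k)
  (hnoise : LaplaceNoise P σ noise) (hξ : FreshSamples P D γ ξ)
  (hindep : IndepFun (fun ω => fun (i : Fin n) (k : ℕ) => noise i k ω)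
      (fun ω => fun (i : Fin n) (k : ℕ) (l : Fin (γ k)) => ξ i k l ω) P)
include hf hg hσ hγ hnoise hξ hindep

omit hf hg hγ [∀ i, IsProbabilityMeasure (D i)] in
/-- Given the history, the noise has second moment at most `2 d σ ^ 2` and mean zero. -/
theorem noise_moments (i : Fin n) (k : ℕ) :
    MemLp (noise i k) 2 P ∧
    (∀ s, MeasurableSet[history hnoise.measurable hξ.measurable k] s →
      ∫ ω in s, ‖noise i k ω‖ ^ 2 ∂P ≤ d * (2 * σ k ^ 2) * P.real s) ∧
    (∀ s (u : Ω → EuclideanSpace ℝ (Fin d)),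
      MeasurableSet[history hnoise.measurable hξ.measurable k] s →
      Measurable[history hnoise.measurable hξ.measurable k] u → MemLp u 2 P →
      ∫ ω in s, inner ℝ (u ω) (noise i k ω) ∂P = 0) := by
  have hF := (history hnoise.measurable hξ.measurable).le k
  have hm := hnoise.measurable i k
  have hi := indep_history_noise hindep hnoise.measurable hξ.measurable hnoise.indep i k
  have hX : Measurable[history hnoise.measurable hξ.measurable k]
      fun _ : Ω => (0 : EuclideanSpace ℝ (Fin d)) := measurable_const
  have he : Measurable (Function.uncurry
      fun (_ : EuclideanSpace ℝ (Fin d)) (v : EuclideanSpace ℝ (Fin d)) => v) := measurable_snd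
  have hv : ∀ _ : EuclideanSpace ℝ (Fin d), ∫⁻ v, ‖v‖ₑ ^ 2 ∂(P.map (noise i k))
      ≤ ENNReal.ofReal (d * (2 * σ k ^ 2)) := fun _ =>
    lintegral_enorm_sq_of_laplace hm (hσ k) (hnoise.law i k)
  have : IsProbabilityMeasure (P.map (noise i k)) :=
    Measure.isProbabilityMeasure_map hm.aemeasurable
  have hmean : ∫ v, v ∂(P.map (noise i k)) = 0 := by
    refine integral_of_laplace hm (hnoise.law i k) ?_
    exact (memLp_two_of_lintegral_enorm_sq_lt_top aestronglyMeasurable_id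
      ((hv 0).trans_lt ENNReal.ofReal_lt_top)).integrable one_le_two
  exact ⟨memLp_two_of_indep hF hX hm hi he hv,
    fun s hs => setIntegral_norm_sq_le_of_indep hF hX hm hi he (by positivity) hv hs,
    fun s u hs hu hu2 => setIntegral_inner_eq_zero_of_indep hF hX hm hi he hv
      (fun _ => hmean) hu hu2 hs⟩

omit hσ hγ in
/-- Given the history, the error of a sampled gradient at a point `x` known from the history has
second moment at most `σg ^ 2` and mean zero. -/
theorem sampleError_moments (i : Fin n) (k : ℕ) (l : Fin (γ k))
    {x : Ω → EuclideanSpace ℝ (Fin d)}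
    (hx : Measurable[history hnoise.measurable hξ.measurable k] x) :
    MemLp (fun ω => g i (x ω) (ξ i k l ω) - gradient (f i) (x ω)) 2 P ∧
    (∀ s, MeasurableSet[history hnoise.measurable hξ.measurable k] s →
      ∫ ω in s, ‖g i (x ω) (ξ i k l ω) - gradient (f i) (x ω)‖ ^ 2 ∂P ≤ σg ^ 2 * P.real s) ∧
    (∀ s (u : Ω → EuclideanSpace ℝ (Fin d)),
      MeasurableSet[history hnoise.measurable hξ.measurable k] s →
      Measurable[history hnoise.measurable hξ.measurable k] u → MemLp u 2 P →
      ∫ ω in s, inner ℝ (u ω) (g i (x ω) (ξ i k l ω) - gradient (f i) (x ω)) ∂P = 0) := by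
  have hF := (history hnoise.measurable hξ.measurable).le k
  have hm := hξ.measurable i k l
  have hi := indep_history_sample hindep hnoise.measurable hξ.measurable hξ.indep_times i k l
  have he := measurable_sampleError hf hg i
  let e := fun x s => g i x s - gradient (f i) x
  have hv : ∀ y, ∫⁻ t, ‖g i y t - gradient (f i) y‖ₑ ^ 2 ∂(P.map (ξ i k l))
      ≤ ENNReal.ofReal (σg ^ 2) := by
    rw [hξ.law]; exact hg.lintegral_sampleError_le i
  have hmean : ∀ y, ∫ t, g i y t - gradient (f i) y ∂(P.map (ξ i k l)) = 0 := by
    rw [hξ.law]; exact hg.integral_sampleError i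
  exact ⟨memLp_two_of_indep (e := e) hF hx hm hi he hv,
    fun s hs => setIntegral_norm_sq_le_of_indep (e := e) hF hx hm hi he (sq_nonneg _) hv hs,
    fun s u hs hu hu2 => setIntegral_inner_eq_zero_of_indep (e := e) hF hx hm hi he hv
      hmean hu hu2 hs⟩

theorem memLp_outputPerturbation (k : ℕ) (i : Fin n) :
    MemLp (outputPerturbation A α β γ g x₀ noise ξ k i) 2 P := by
  induction k generalizing i with
  | zero => exact memLp_const (x₀ i)
  | succ k ih =>
    have hT := MemLp.comp_lipschitz (hf.lipschitz i) (hf.measurable_gradient i) (ih i)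
    have hx := measurable_outputPerturbation (A := A) (α := α) (β := β) (x₀ := x₀)
      hnoise.measurable hξ.measurable hg.measurable k i
    have hsum : MemLp (fun ω => ∑ j, A i j • outputPerturbation A α β γ g x₀ noise ξ k j ω) 2 P :=
      memLp_finsetSum _ fun j _ => (ih j).const_smul (A i j)
    have hN := memLp_stepNoise (a := A i) (b := β k) (t := α k)
      (fun j => (noise_moments hσ hnoise hξ hindep j k).1)
      (fun l => (sampleError_moments hf hg hnoise hξ hindep i k l hx).1)
    refine MemLp.ae_eq (ae_of_all _ fun ω => ?_)
      (((((ih i).const_smul (1 - β k)).add (hsum.const_smul (β k))).sub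
        (hT.const_smul (α k))).add hN)
    have h1 := outputPerturbation_succ_sub (A := A) (α := α) (β := β) (g := g) (x₀ := x₀)
      (noise := noise) (ξ := ξ) (Nat.one_le_iff_ne_zero.1 (hγ k)) (fun i => gradient (f i)) 0 i ω
      (fun j => rfl)
    rw [sub_zero, sub_zero] at h1
    exact h1.symm

omit hg hσ hγ hnoise hξ hindep [∀ i, MeasurableSpace (Ξ i)]
  [∀ i, IsProbabilityMeasure (D i)] in
theorem setIntegral_lyapunov_drift_le (hn : n ≠ 0) (hA : A ∈ doublyStochastic ℝ (Fin n))
    (h1 : secondSingularValue A < 1) {p : EuclideanSpace ℝ (Fin d)}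
    (hp : ∑ i, gradient (f i) p = 0) {c K : ℝ}
    (hc : c = 1 + 4 * (∑ i, L i) ^ 2 / m ^ 2)
    (hK : K = (∑ i, L i) ^ 2 + c * ((1 + 2 / (1 - secondSingularValue A)) *
      (2 * (∑ i, L i) ^ 2 * n + 2 * ∑ i, ‖gradient (f i) p‖ ^ 2)))
    {a b : ℝ} (ha : 0 < a) (hb : 0 < b) (hb1 : b < 1)
    (hab : 3 * m * a ≤ 2 * (1 - secondSingularValue A) * b)
    {x : Fin n → Ω → EuclideanSpace ℝ (Fin d)} (hx : ∀ i, MemLp (x i) 2 P)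
    (hZ : ∀ i, MemLp (fun ω => (1 - b) • x i ω + b • ∑ j, A i j • x j ω
      - a • gradient (f i) (x i ω) - p) 2 P) (s : Set Ω) :
    ∫ ω in s, lyapunov c (fun i => (1 - b) • x i ω + b • ∑ j, A i j • x j ω
        - a • gradient (f i) (x i ω) - p) ∂P
      ≤ (1 - m / 2 * a + K * (a ^ 2 / b)) * ∫ ω in s, lyapunov c (fun i => x i ω - p) ∂P
        + K * (a ^ 2 / b) * P.real s := by
  have hW : Integrable (fun ω => lyapunov c fun i => x i ω - p) P :=
    integrable_lyapunov c fun i => (hx i).sub (memLp_const p)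
  generalize hq : 1 - m / 2 * a + K * (a ^ 2 / b) = q
  generalize hr : K * (a ^ 2 / b) = r
  have h3 : Integrable (fun ω => q * lyapunov c (fun i => x i ω - p) + r) P :=
    (hW.const_mul q).add (integrable_const r)
  calc ∫ ω in s, lyapunov c (fun i => (1 - b) • x i ω + b • ∑ j, A i j • x j ω
        - a • gradient (f i) (x i ω) - p) ∂P
      ≤ ∫ ω in s, (q * lyapunov c (fun i => x i ω - p) + r) ∂P := by
        refine integral_mono (integrable_lyapunov c hZ).integrableOn h3.integrableOn fun ω => ?_
        rw [← hq, ← hr]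
        exact lyapunov_drift_le hn hA rfl h1 hf.m_pos hf.lipschitz_sum hf.strongly_convex hp ha hb
          hb1 hab hc hK fun i => x i ω
    _ = _ := by
        rw [integral_add (hW.const_mul _).integrableOn (integrable_const _), integral_const_mul]
        simp [mul_comm]

/-- One step of the algorithm, integrated over a past event `s`: the drift of the noiseless step
plus the second moment of the noise of the round. -/
theorem setIntegral_lyapunov_succ_le (hn : n ≠ 0) (hA : A ∈ doublyStochastic ℝ (Fin n))
    (h1 : secondSingularValue A < 1) {p : EuclideanSpace ℝ (Fin d)}
    (hp : ∑ i, gradient (f i) p = 0) {c K : ℝ}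
    (hc : c = 1 + 4 * (∑ i, L i) ^ 2 / m ^ 2)
    (hK : K = (∑ i, L i) ^ 2 + c * ((1 + 2 / (1 - secondSingularValue A)) *
      (2 * (∑ i, L i) ^ 2 * n + 2 * ∑ i, ‖gradient (f i) p‖ ^ 2)))
    {k : ℕ} (hα : 0 < α k) (hβ : 0 < β k) (hβ1 : β k < 1)
    (hαβ : 3 * m * α k ≤ 2 * (1 - secondSingularValue A) * β k) {s : Set Ω}
    (hs : MeasurableSet[history hnoise.measurable hξ.measurable k] s) :
    ∫ ω in s, lyapunov c (fun i => outputPerturbation A α β γ g x₀ noise ξ (k + 1) i ω - p) ∂P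
      ≤ (1 - m / 2 * α k + K * (α k ^ 2 / β k)) *
          ∫ ω in s, lyapunov c (fun i => outputPerturbation A α β γ g x₀ noise ξ k i ω - p) ∂P
        + (K * (α k ^ 2 / β k) + (1 + c) * (n * (2 * β k ^ 2 * (n * (n * (d * (2 * σ k ^ 2))))
            + 2 * α k ^ 2 * σg ^ 2))) * P.real s := by
  have hγ0 : γ k ≠ 0 := Nat.one_le_iff_ne_zero.1 (hγ k)
  obtain ⟨x, hxdef⟩ : ∃ x : Fin n → Ω → EuclideanSpace ℝ (Fin d),
    x = outputPerturbation A α β γ g x₀ noise ξ k := ⟨_, rfl⟩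
  have hsucc : ∀ ω, (fun i => outputPerturbation A α β γ g x₀ noise ξ (k + 1) i ω - p)
      = fun i => ((1 - β k) • x i ω + β k • ∑ j, A i j • x j ω
          - α k • gradient (f i) (x i ω) - p)
        + (β k • ∑ j, A i j • noise j k ω
          - α k • agentMean fun l => g i (x i ω) (ξ i k l ω) - gradient (f i) (x i ω)) :=
    fun ω => funext fun i => outputPerturbation_succ_sub (x := fun j => x j ω) hγ0
      (fun i => gradient (f i)) p i ω (fun j => by rw [hxdef])
  simp only [hsucc]
  have hx : ∀ i, Measurable[history hnoise.measurable hξ.measurable k] (x i) := by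
    rw [hxdef]
    exact measurable_outputPerturbation hnoise.measurable hξ.measurable hg.measurable k
  have hx2 : ∀ i, MemLp (x i) 2 P := by
    rw [hxdef]
    exact memLp_outputPerturbation hf hg hσ hγ hnoise hξ hindep k
  rw [← hxdef]
  clear hsucc hxdef
  have hT2 := fun i => MemLp.comp_lipschitz (hf.lipschitz i) (hf.measurable_gradient i) (hx2 i)
  have hc0 : 0 ≤ c := by
    have : 0 ≤ 4 * (∑ i, L i) ^ 2 / m ^ 2 := by positivity
    linarith
  have hZ : ∀ i, Measurable[history hnoise.measurable hξ.measurable k] fun ω =>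
      (1 - β k) • x i ω + β k • ∑ j, A i j • x j ω - α k • gradient (f i) (x i ω) - p :=
    fun i => ((((hx i).const_smul (1 - β k)).add
      ((Finset.measurable_fun_sum _ fun j _ => (hx j).const_smul (A i j)).const_smul (β k))).sub
      (((hf.measurable_gradient i).comp (hx i)).const_smul (α k))).sub measurable_const
  have hZ2 : ∀ i, MemLp (fun ω =>
      (1 - β k) • x i ω + β k • ∑ j, A i j • x j ω - α k • gradient (f i) (x i ω) - p) 2 P :=
    fun i => by
      have hsum : MemLp (fun ω => ∑ j, A i j • x j ω) 2 P :=
        memLp_finsetSum _ fun j _ => (hx2 j).const_smul (A i j)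
      exact ((((hx2 i).const_smul (1 - β k)).add (hsum.const_smul (β k))).sub
        ((hT2 i).const_smul (α k))).sub (memLp_const p)
  have hν := fun j => noise_moments hσ hnoise hξ hindep j k
  have he := fun i l => sampleError_moments hf hg hnoise hξ hindep i k l (hx i)
  have hN2 : ∀ i, MemLp (fun ω => β k • ∑ j, A i j • noise j k ω
      - α k • agentMean fun l => g i (x i ω) (ξ i k l ω) - gradient (f i) (x i ω)) 2 P :=
    fun i => memLp_stepNoise (fun j => (hν j).1) (fun l => (he i l).1)
  have hA1 : ∀ i j, |A i j| ≤ 1 := fun i j => by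
    rw [abs_of_nonneg (nonneg_of_mem_doublyStochastic hA)]
    exact le_one_of_mem_doublyStochastic hA
  have hstep := setIntegral_lyapunov_add_le (s := s) (c := c) hc0 hZ hZ2 hN2
    (v := 2 * β k ^ 2 * (n * (n * (d * (2 * σ k ^ 2)))) + 2 * α k ^ 2 * σg ^ 2)
    (fun i u hu hu2 => setIntegral_inner_stepNoise (fun j => (hν j).1) (fun l => (he i l).1) hu2
      (fun j => (hν j).2.2 s u hs hu hu2) (fun l => (he i l).2.2 s u hs hu hu2))
    (fun i => (setIntegral_norm_sq_stepNoise_le hγ0 (hA1 i) (fun j => (hν j).1)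
      (fun l => (he i l).1) (fun j => (hν j).2.1 s hs) (fun l => (he i l).2.1 s hs)).trans_eq
      (by ring))
  have hdrift := setIntegral_lyapunov_drift_le (P := P) hf hn hA h1 hp hc hK hα hβ hβ1 hαβ hx2
    hZ2 s
  rw [add_mul (K * (α k ^ 2 / β k)), ← add_assoc]
  exact hstep.trans (add_le_add_left hdrift _)
end Iterates

/-! ### Convergence -/

theorem theorem3 {n d : ℕ}
    {Ω : Type*} [MeasurableSpace Ω] (P : Measure Ω) [IsProbabilityMeasure P]
    {Ξ : Fin n → Type*} [∀ i, MeasurableSpace (Ξ i)]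
    (D : ∀ i, Measure (Ξ i)) [∀ i, IsProbabilityMeasure (D i)]
    (ℓ : ∀ i, EuclideanSpace ℝ (Fin d) → Ξ i → ℝ) (hℓ : ∀ i x, Integrable (ℓ i x) (D i))
    (L : Fin n → ℝ) (m : ℝ) (hf : SmoothStronglyConvex (expectedCost D ℓ) L m)
    (g : ∀ i, EuclideanSpace ℝ (Fin d) → Ξ i → EuclideanSpace ℝ (Fin d)) (σg : ℝ)
    (hg : UnbiasedBoundedVariance D (expectedCost D ℓ) g σg)
    (G : SimpleGraph (Fin n)) (A : Matrix (Fin n) (Fin n) ℝ) (hA : ConnectedWeights G A)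
    (α β σ : ℕ → ℝ) (γ : ℕ → ℕ)
    (hstep : TwoTimeScale n (secondSingularValue A) m (∑ i, L i ^ 2) α β σ γ)
    (hdiv : Tendsto (fun K => ∑ k ∈ Finset.range K, α k) atTop atTop)
    (noise : Fin n → ℕ → Ω → EuclideanSpace ℝ (Fin d)) (hnoise : LaplaceNoise P σ noise)
    (ξ : ∀ (i : Fin n) (k : ℕ), Fin (γ k) → Ω → Ξ i) (hξ : FreshSamples P D γ ξ)
    (hindep : IndepFun (fun ω => fun (i : Fin n) (k : ℕ) => noise i k ω)
      (fun ω => fun (i : Fin n) (k : ℕ) (l : Fin (γ k)) => ξ i k l ω) P)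
    (x₀ : Fin n → EuclideanSpace ℝ (Fin d)) :
    ∃ xstar : EuclideanSpace ℝ (Fin d),
      (∀ y, ∑ i, expectedCost D ℓ i xstar ≤ ∑ i, expectedCost D ℓ i y) ∧
      ∀ i,
        (∀ k, Integrable
          (fun ω => ‖outputPerturbation A α β γ g x₀ noise ξ k i ω - xstar‖ ^ 2) P) ∧
        Tendsto
          (fun k => ∫ ω, ‖outputPerturbation A α β γ g x₀ noise ξ k i ω - xstar‖ ^ 2 ∂P)
          atTop (𝓝 0) ∧
        ∀ᵐ ω ∂P, Tendsto
          (fun k => outputPerturbation A α β γ g x₀ noise ξ k i ω) atTop (𝓝 xstar) := by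
  have hn : n ≠ 0 := by
    rintro rfl
    exact (hA.connected.nonempty).elim fun i => i.elim0
  have hm := hf.m_pos
  -- the bound on the positive ratio `α 0 / β 0` forces a spectral gap
  have hratio : ∀ k, 3 * m * α k ≤ 2 * (1 - secondSingularValue A) * β k := fun k => by
    have h1 := (hstep.ratio_le k).trans (min_le_left _ _)
    rw [div_le_div_iff₀ (hstep.β_pos k) (by positivity)] at h1
    linarith
  have hgap : secondSingularValue A < 1 := by
    by_contra! h
    have h1 := hratio 0
    have h2 : 0 < 3 * m * α 0 := by have := hstep.α_pos 0; positivity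
    nlinarith [hstep.β_pos 0]
  obtain ⟨p, hp⟩ := hf.exists_sum_gradient_eq_zero hn
  refine ⟨p, hf.sum_le_sum hp, ?_⟩
  obtain ⟨c, hc⟩ : ∃ c, c = 1 + 4 * (∑ i, L i) ^ 2 / m ^ 2 := ⟨_, rfl⟩
  obtain ⟨K, hK⟩ : ∃ K, K = (∑ i, L i) ^ 2 + c * ((1 + 2 / (1 - secondSingularValue A)) *
      (2 * (∑ i, L i) ^ 2 * n + 2 * ∑ i, ‖gradient (expectedCost D ℓ i) p‖ ^ 2)) := ⟨_, rfl⟩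
  have hc1 : 1 ≤ c := by
    have : 0 ≤ 4 * (∑ i, L i) ^ 2 / m ^ 2 := by positivity
    linarith
  have hK0 : 0 ≤ K := by
    have : 0 < 1 - secondSingularValue A := by linarith
    rw [hK]
    positivity
  have hx2 := memLp_outputPerturbation (A := A) (α := α) (β := β) (x₀ := x₀) hf hg hstep.σ_pos
    hstep.γ_pos hnoise hξ hindep
  have hη : Summable fun k => K * (α k ^ 2 / β k) := hstep.summable_α_sq_div_β.mul_left K
  have hη0 : ∀ k, 0 ≤ K * (α k ^ 2 / β k) := fun k => by
    have := hstep.β_pos k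
    positivity
  -- `β k < 1`, so `∑ α k ^ 2` is dominated by `∑ α k ^ 2 / β k`
  have hα2 : Summable fun k => α k ^ 2 := by
    refine Summable.of_nonneg_of_le (fun k => sq_nonneg _) (fun k => ?_) hstep.summable_α_sq_div_β
    rw [le_div_iff₀ (hstep.β_pos k)]
    exact mul_le_of_le_one_right (sq_nonneg _) (hstep.β_lt_one k).le
  have hδ : Summable fun k => K * (α k ^ 2 / β k) +
      (1 + c) * (n * (2 * β k ^ 2 * (n * (n * (d * (2 * σ k ^ 2)))) + 2 * α k ^ 2 * σg ^ 2)) := by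
    have h1 : Summable fun k => (1 + c) * n * (4 * n * n * d) * (β k ^ 2 * σ k ^ 2)
        + (1 + c) * n * (2 * σg ^ 2) * α k ^ 2 :=
      (hstep.summable_β_sq_mul_σ_sq.mul_left _).add (hα2.mul_left _)
    refine hη.add (h1.congr fun k => ?_)
    ring
  have hdiv' : Tendsto (fun K => ∑ k ∈ Finset.range K, m / 2 * α k) atTop atTop := by
    simp only [← Finset.mul_sum]
    exact hdiv.const_mul_atTop (by positivity)
  obtain ⟨hmean, hae⟩ := robbins_siegmund (P := P)
    (F := history hnoise.measurable hξ.measurable)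
    (W := fun k ω => lyapunov c fun i => outputPerturbation A α β γ g x₀ noise ξ k i ω - p)
    (fun k => (Measurable.lyapunov c fun i => (measurable_outputPerturbation hnoise.measurable
      hξ.measurable hg.measurable k i).sub measurable_const).stronglyMeasurable)
    (fun k => integrable_lyapunov c fun i => (hx2 k i).sub (memLp_const p))
    (fun k ω => lyapunov_nonneg (by linarith) _)
    (fun k => by have := hstep.α_pos k; positivity) hη0 hη
    (fun k => add_nonneg (hη0 k) (by positivity)) hδ hdiv'
    (fun k s hs => setIntegral_lyapunov_succ_le hf hg hstep.σ_pos hstep.γ_pos hnoise hξ hindep hn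
      hA.doubly_stochastic hgap hp hc hK (hstep.α_pos k) (hstep.β_pos k) (hstep.β_lt_one k)
      (hratio k) hs)
  intro i
  have hint := fun k => ((hx2 k i).sub (memLp_const p)).integrable_norm_sq
  refine ⟨hint, ?_, ?_⟩
  · refine squeeze_zero (fun k => integral_nonneg fun ω => sq_nonneg _) (fun k => ?_)
      (by simpa only [mul_zero] using hmean.const_mul 2)
    rw [← integral_const_mul]
    exact integral_mono (hint k)
      ((integrable_lyapunov c fun i => (hx2 k i).sub (memLp_const p)).const_mul 2)
      fun ω => norm_sq_le_lyapunov hc1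
        (fun i => outputPerturbation A α β γ g x₀ noise ξ k i ω - p) i
  · filter_upwards [hae] with ω hω
    rw [tendsto_iff_norm_sub_tendsto_zero]
    have h1 : Tendsto (fun k => ‖outputPerturbation A α β γ g x₀ noise ξ k i ω - p‖ ^ 2) atTop
        (𝓝 0) :=
      squeeze_zero (fun k => sq_nonneg _) (fun k => norm_sq_le_lyapunov hc1
        (fun i => outputPerturbation A α β γ g x₀ noise ξ k i ω - p) i)
        (by simpa only [mul_zero] using hω.const_mul 2)
    simpa using h1.sqrt
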